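/- Stochastic linear bandits with parameter noise. Let $d\ge 1$, let $p\in(2,\infty]$ with dual exponent $q\in[1,2)$, $\frac1p+\frac1q=1$, and let $\mathcal A=\{a\in\mathbb R^d:\|a\|_p\le 1\}$. For a reward distribution (a Borel probability measure) $\mathcal D$ on $\mathbb R^d$ with mean $\theta^\star$ and covariance matrix $\Sigma$, a possibly randomized bandit algorithm $\mathcal{ALG}$ chooses, in each round $t=1,\dots,T$, an action $a_t\in\mathcal A$ from its internal randomness and the rewards observed so far; then $\theta_t\sim\mathcal D$ is drawn independently of the past and of the algorithm's internal randomness, and the reward $X_t=a_t^\top\theta_t$ is observed. Its pseudo-regret is $\mathcal R_T(\mathcal{ALG},\mathcal D)=\sum_{t=1}^T(a^\star-a_t)^\top\theta^\star$, where $a^\star\in\arg\max_{a\in\mathcal A}a^\top\theta^\star$; and $\sigma_{\max}^2=\max_{a\in\mathcal A}a^\top\Sigma a$. **Theorem.** There are absolute constants $c>0$ and $k\in\mathbb N$ such that the following holds. For all $d\ge1$, all $p\in(2,\infty]$ with dual exponent $q\in[1,2)$, all integers $T\ge d^{\frac{4}{2-q}}$, all $\sigma>0$ and every bandit algorithm $\mathcal{ALG}$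 on $\mathcal A$, there is a reward distribution $\mathcal D$ on $\mathbb R^d$ such that $\sigma_{\max}^2=\sigma^2/2$, such that for every $a\in\mathcal A$ one has $|a^\top\theta|\le\max\{1,\sigma\}$ for $\mathcal D$-almost every $\theta$ (so the rewards are bounded by $1$ whenever $\sigma\le 1$), and $$\mathbb E\big[\mathcal R_T(\mathcal{ALG},\mathcal D)\big]\ \ge\ \frac{c\,d\sqrt{T\sigma^2}}{(1+\log T)^k}.$$ That is, the expected regret is $\widetilde\Omega\big(d\sqrt{T\sigma^2}\big)$. -/

import Mathlib

open MeasureTheory ProbabilityTheory Matrix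

noncomputable section

/-- The closed unit ball of `ℓ_p` in `ℝ^d`, `p = ∞` included. -/
def lpBall (d : ℕ) (p : ENNReal) : Set (Fin d → ℝ) :=
  {a | ‖WithLp.toLp p a‖ ≤ 1}

/-- The expectation `θ⋆` of a reward distribution. -/
def meanVector {d : ℕ} (ν : Measure (Fin d → ℝ)) : Fin d → ℝ :=
  fun i => ∫ θ, θ i ∂ν

/-- The covariance matrix `Σ` of a reward distribution. -/
def rewardCov {d : ℕ} (ν : Measure (Fin d → ℝ)) : Matrix (Fin d) (Fin d) ℝ :=
  Matrix.of fun i j => covariance (fun θ => θ i) (fun θ => θ j) ν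

/-- The variance `σ²(a) = aᵀ Σ a` of the action `a`. -/
def actionVariance {d : ℕ} (ν : Measure (Fin d → ℝ)) (a : Fin d → ℝ) : ℝ :=
  a ⬝ᵥ (rewardCov ν *ᵥ a)

/-- A (possibly randomized) bandit algorithm on the action set `A`. It draws an internal random
seed once, and in round `t` (rounds are counted from `0`) plays an action that is a function of the
seed and of the `t` rewards observed so far. Its own past actions are functions of the same data,
so they need not be passed as arguments. -/
structure BanditAlgorithm (d : ℕ) (A : Set (Fin d → ℝ)) where
  Seed : Type*
  [measurableSpace : MeasurableSpace Seed]
  seedLaw : Measure Seed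
  [isProbabilityMeasure : IsProbabilityMeasure seedLaw]
  act : (t : ℕ) → Seed → (Fin t → ℝ) → (Fin d → ℝ)
  measurable_act : ∀ t, Measurable fun x : Seed × (Fin t → ℝ) => act t x.1 x.2
  act_mem : ∀ t s x, act t s x ∈ A

namespace BanditAlgorithm

attribute [instance] BanditAlgorithm.measurableSpace BanditAlgorithm.isProbabilityMeasure

variable {d : ℕ} {A : Set (Fin d → ℝ)}

/-- The rewards `X_0, …, X_{t-1}` observed before round `t`, for the seed `s` and the sequence of
reward vectors `θ`: the reward of round `t` is `X_t = a_tᵀ θ_t`. -/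
def rewards (alg : BanditAlgorithm d A) (s : alg.Seed) (θ : ℕ → Fin d → ℝ) :
    (t : ℕ) → (Fin t → ℝ)
  | 0 => Fin.elim0
  | t + 1 => Fin.snoc (rewards alg s θ t) (alg.act t s (rewards alg s θ t) ⬝ᵥ θ t)

/-- The action `a_t` played in round `t`. -/
def action (alg : BanditAlgorithm d A) (s : alg.Seed) (θ : ℕ → Fin d → ℝ) (t : ℕ) : Fin d → ℝ :=
  alg.act t s (alg.rewards s θ t)

/-- The joint law of the seed and the reward vectors: the `θ_t` are i.i.d. with law `ν`, and
independent of the seed. -/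
def law (alg : BanditAlgorithm d A) (ν : Measure (Fin d → ℝ)) [IsProbabilityMeasure ν] :
    Measure (alg.Seed × (ℕ → Fin d → ℝ)) :=
  alg.seedLaw.prod (Measure.infinitePi fun _ : ℕ => ν)

/-- The pseudo-regret `∑_{t < T} (a⋆ - a_t)ᵀ θ⋆` over `T` rounds, relative to the action `aStar`. -/
def regret (alg : BanditAlgorithm d A) (ν : Measure (Fin d → ℝ)) (aStar : Fin d → ℝ) (T : ℕ)
    (ω : alg.Seed × (ℕ → Fin d → ℝ)) : ℝ :=
  ∑ t ∈ Finset.range T, (aStar - alg.action ω.1 ω.2 t) ⬝ᵥ meanVector ν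

end BanditAlgorithm

end

/-! The hard instances have mean `(M, ±Δ, …, ±Δ)` with unknown signs and `M` of order `σ`, and
independent bounded noise of scale `s` of order `σ` on the first coordinate and `s * ρ` on the `n =
d - 1` others. Write `r = 1/p` and let `u` be of order `1/√T`. Lowering the first entry of the
action by `3nu/4` makes room for entries `±u^r` elsewhere (`cons_mem_lpBall`). Since `Δ = M
u^(1-r)`, each correct sign then earns `M u`, so knowing the signs is worth order `n M u` per round,
which is order `d σ √T` over `T` rounds. It remains to see that the signs cannot be learnt cheaply.

An action with `a 0 ≥ 1/2` suffers the noise of the first coordinate, so its information about the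
signs is of order at most `(Δ/σ)² ∑ a_i²`, and the ball bounds `∑ a_i²` by `u^(2r) (n + 2(1 - a
0)/u)` (`sum_sq_le_of_mem_lpBall`). An action with `a 0 < 1/2` may escape that noise, but it gives
up more than `M/2` and still meets the noise of scale `s * ρ` (`sum_snr_le`). Hence gain and
information are both bounded by affine functions of the exploration cost `1 - a 0`, and with small
constants the loss `M (1 - a 0)` outweighs what it buys (`card_mul_le_sum_regret`).

Bounded noise has densities with zeros, so information is measured by Hellinger affinity rather than
relative entropy. A change of the mean leaves the reward of `a` unaltered if the noise vector is
shifted by `noiseShift`; this represents the two laws of the history by squared amplitudes on one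
space, whose affinity drops per round by at most a multiple of the expected `snr`
(`exists_latent_amplitudes`). `actionMean_sub_le` turns this into a bound on differences of
expectations which involves second moments of `f` instead of its supremum, as is needed because good
actions have small entries. Averaging over sign patterns and then over the seed yields one hard
environment.

The assumption on `T` makes `d^(1-r) ρ` small, so that the minor coordinates add little to rewards
and variances (`horizon_bounds`). Dimension one has no minor coordinates and is a two-point test of
the sign of the mean. -/

/-! ### One-dimensional bounded noise and its Hellinger affinity. -/

/-- The square root of a bounded noise density on `ℝ` which is even, concentrated on
`4/5 ≤ |x| ≤ 1`, and whose Hellinger affinity with its translates is `1 - O(v²)`. -/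
structure NoiseAmplitude where
  toFun : ℝ → ℝ
  hellingerConst : ℝ
  continuous_toFun : Continuous toFun
  nonneg : ∀ x, 0 ≤ toFun x
  even : ∀ x, toFun (-x) = toFun x
  le_abs_of_ne_zero : ∀ x, toFun x ≠ 0 → 4 / 5 ≤ |x|
  abs_le_of_ne_zero : ∀ x, toFun x ≠ 0 → |x| ≤ 1
  integral_sq : ∫ x, toFun x ^ 2 = 1
  hellingerConst_nonneg : 0 ≤ hellingerConst
  one_le_affinity_add : ∀ v, 1 ≤ (∫ x, toFun x * toFun (x - v)) + hellingerConst * v ^ 2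

namespace NoiseAmplitude

/-- A pair of tents centred at `±9/10`. -/
noncomputable def twoTents (x : ℝ) : ℝ := max 0 (1 / 10 - |(|x| - 9 / 10)|)

lemma continuous_twoTents : Continuous twoTents := by unfold twoTents; fun_prop

lemma twoTents_nonneg (x : ℝ) : 0 ≤ twoTents x := le_max_left _ _

lemma twoTents_ne_zero {x : ℝ} (h : twoTents x ≠ 0) : 4 / 5 ≤ |x| ∧ |x| ≤ 1 := by
  have h1 : 0 < 1 / 10 - |(|x| - 9 / 10)| := by
    by_contra! h2
    exact h (max_eq_left h2)
  have := abs_lt.1 (sub_pos.1 h1)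
  constructor <;> linarith [this.1, this.2]

lemma abs_twoTents_sub_le (x y : ℝ) : |twoTents x - twoTents y| ≤ |x - y| := by
  have h1 := abs_max_sub_max_le_max (0 : ℝ) (1 / 10 - |(|x| - 9 / 10)|) 0
    (1 / 10 - |(|y| - 9 / 10)|)
  have h2 := abs_abs_sub_abs_le (|y| - 9 / 10) (|x| - 9 / 10)
  refine h1.trans (max_le (by simp) ?_)
  calc _ = |(|(|y| - 9 / 10)| - |(|x| - 9 / 10)|)| := by congr 1; ring
    _ ≤ _ := h2
    _ = |(|y| - |x|)| := by congr 1; ring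
    _ ≤ |y - x| := abs_abs_sub_abs_le y x
    _ = _ := abs_sub_comm _ _

lemma hasCompactSupport_twoTents : HasCompactSupport twoTents := by
  refine HasCompactSupport.of_support_subset_isCompact (isCompact_Icc (a := (-1 : ℝ)) (b := 1)) ?_
  intro x hx
  exact abs_le.1 (twoTents_ne_zero hx).2

lemma integral_twoTents_sq_pos : 0 < ∫ x, twoTents x ^ 2 := by
  refine Continuous.integral_pos_of_hasCompactSupport_nonneg_nonzero (x := 9 / 10)
    (continuous_twoTents.pow 2) ?_ (fun x => sq_nonneg _) ?_
  · have := hasCompactSupport_twoTents.mul_right (f' := twoTents)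
    simp only [sq]; exact this
  · unfold twoTents; norm_num

lemma integrable_mul_of_hasCompactSupport {g h : ℝ → ℝ} (hg : Continuous g)
    (hs : HasCompactSupport g) (hh : Continuous h) : Integrable fun x => g x * h x :=
  (hg.mul hh).integrable_of_hasCompactSupport hs.mul_right

/-- The normalised pair of tents is Lipschitz with compact support, so its squared `L²` distance to
a translate by `v` is `O(v²)`; expanding the square turns this into a bound for the affinity. -/
lemma exists_noiseAmplitude : Nonempty NoiseAmplitude := by
  set I := ∫ x, twoTents x ^ 2 with hI
  have hI0 : 0 < I := integral_twoTents_sq_pos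
  set c := (Real.sqrt I)⁻¹ with hc
  have hc0 : 0 < c := by positivity
  have hcI : c ^ 2 * I = 1 := by
    rw [hc, inv_pow, Real.sq_sqrt hI0.le, inv_mul_cancel₀ hI0.ne']
  have hcont : Continuous fun x => c * twoTents x := continuous_twoTents.const_mul c
  have hsupp : HasCompactSupport fun x => c * twoTents x := hasCompactSupport_twoTents.mul_left
  have hsq : ∫ x, (c * twoTents x) ^ 2 = 1 := by
    simp_rw [mul_pow]
    rw [integral_const_mul, hcI]
  refine ⟨⟨fun x => c * twoTents x, 2 * c ^ 2, hcont, fun x => mul_nonneg hc0.le (twoTents_nonneg x),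
    fun x => by simp [twoTents], fun x hx => (twoTents_ne_zero (right_ne_zero_of_mul hx)).1,
    fun x hx => (twoTents_ne_zero (right_ne_zero_of_mul hx)).2, hsq, by positivity, fun v => ?_⟩⟩
  set g : ℝ → ℝ := fun x => c * twoTents x with hg
  have hgv : Continuous fun x => g (x - v) := hcont.comp (continuous_sub_right v)
  have hi1 : Integrable fun x => g x ^ 2 := by
    simpa only [sq] using integrable_mul_of_hasCompactSupport hcont hsupp hcont
  have hi2 : Integrable fun x => g (x - v) ^ 2 := hi1.comp_sub_right v
  have hi3 : Integrable fun x => g x * g (x - v) :=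
    integrable_mul_of_hasCompactSupport hcont hsupp hgv
  have hs2 : ∫ x, g (x - v) ^ 2 = 1 := by
    rw [integral_sub_right_eq_self (fun x => g x ^ 2) v]; exact hsq
  have e1 : ∫ x, (g x - g (x - v)) ^ 2 = 2 - 2 * ∫ x, g x * g (x - v) := by
    have : ∀ x, (g x - g (x - v)) ^ 2 = g x ^ 2 + g (x - v) ^ 2 - 2 * (g x * g (x - v)) := by
      intro x; ring
    simp_rw [this]
    have h12 : Integrable fun x => g x ^ 2 + g (x - v) ^ 2 := hi1.add hi2
    rw [integral_sub h12 (hi3.const_mul 2), integral_add hi1 hi2, hs2,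
      integral_const_mul, hsq]
    norm_num
  let S : Set ℝ := Set.Icc (-1) 1
  have hSi : Integrable (S.indicator fun _ => c ^ 2 * v ^ 2) :=
    (integrable_indicator_iff measurableSet_Icc).2 (integrableOn_const (by simp))
  -- The difference vanishes unless `x` or `x - v` lies in `[-1, 1]`. These two sets have total
  -- length `4`, whence `4c²v²`, and halving gives the constant `2c²`.
  have e2 : ∫ x, (g x - g (x - v)) ^ 2 ≤ ∫ x, (S.indicator (fun _ => c ^ 2 * v ^ 2) x
      + S.indicator (fun _ => c ^ 2 * v ^ 2) (x - v)) := by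
    refine integral_mono_of_nonneg (Filter.Eventually.of_forall fun x => sq_nonneg _)
      (hSi.add (hSi.comp_sub_right v)) (Filter.Eventually.of_forall fun x => ?_)
    have hlip : (g x - g (x - v)) ^ 2 ≤ c ^ 2 * v ^ 2 := by
      rw [hg, ← mul_sub, mul_pow]
      refine mul_le_mul_of_nonneg_left ?_ (sq_nonneg c)
      have := abs_twoTents_sub_le x (x - v)
      rw [sub_sub_cancel] at this
      exact sq_le_sq.2 this
    have hp : 0 ≤ c ^ 2 * v ^ 2 := by positivity
    have hz : ∀ y, y ∉ S → g y = 0 := by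
      intro y hy
      by_contra h
      exact hy (abs_le.1 (twoTents_ne_zero (right_ne_zero_of_mul h)).2)
    by_cases h1 : x ∈ S <;> by_cases h2 : x - v ∈ S <;> simp only [Set.indicator, h1, h2, if_true,
      if_false] <;> try linarith
    rw [hz _ h1, hz _ h2]; simp
  have e3 : ∫ x, (S.indicator (fun _ => c ^ 2 * v ^ 2) x
      + S.indicator (fun _ => c ^ 2 * v ^ 2) (x - v)) = 4 * (c ^ 2 * v ^ 2) := by
    rw [integral_add hSi (hSi.comp_sub_right v),
      integral_sub_right_eq_self (fun x => S.indicator (fun _ => c ^ 2 * v ^ 2) x) v,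
      integral_indicator measurableSet_Icc, setIntegral_const]
    simp [Measure.real]
    norm_num; ring
  linarith

variable (g : NoiseAmplitude)

lemma integrable_sq : Integrable fun x => g.toFun x ^ 2 :=
  (integrable_of_integral_eq_one g.integral_sq)

lemma hasCompactSupport : HasCompactSupport g.toFun :=
  HasCompactSupport.of_support_subset_isCompact (isCompact_Icc (a := (-1 : ℝ)) (b := 1))
    fun x hx => abs_le.1 (g.abs_le_of_ne_zero x hx)

/-- The noise law with density the square of the amplitude. -/
noncomputable def law : Measure ℝ := volume.withDensity fun x => ENNReal.ofReal (g.toFun x ^ 2)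

lemma measurable_density : Measurable fun x => ENNReal.ofReal (g.toFun x ^ 2) :=
  ENNReal.measurable_ofReal.comp (g.continuous_toFun.pow 2).measurable

instance : IsProbabilityMeasure g.law := by
  constructor
  rw [law, withDensity_apply _ MeasurableSet.univ, Measure.restrict_univ,
    ← ofReal_integral_eq_lintegral_ofReal g.integrable_sq
      (Filter.Eventually.of_forall fun x => sq_nonneg _), g.integral_sq, ENNReal.ofReal_one]

lemma integral_law (f : ℝ → ℝ) : ∫ x, f x ∂g.law = ∫ x, g.toFun x ^ 2 * f x := by
  rw [law, integral_withDensity_eq_integral_toReal_smul g.measurable_density (by simp)]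
  simp [ENNReal.toReal_ofReal, sq_nonneg]

lemma ae_abs_mem : ∀ᵐ x ∂g.law, 4 / 5 ≤ |x| ∧ |x| ≤ 1 := by
  rw [law, ae_withDensity_iff g.measurable_density]
  refine Filter.Eventually.of_forall fun x hx => ?_
  have : g.toFun x ≠ 0 := by rintro h; simp [h] at hx
  exact ⟨g.le_abs_of_ne_zero x this, g.abs_le_of_ne_zero x this⟩

lemma memLp_id (p : ENNReal) : MemLp (fun x : ℝ => x) p g.law :=
  MemLp.of_bound (by fun_prop) 1 (g.ae_abs_mem.mono fun _ h => h.2)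

lemma integral_id_law : ∫ x, x ∂g.law = 0 := by
  rw [integral_law]
  have h := integral_neg_eq_self (fun x => g.toFun x ^ 2 * x) volume
  simp only [g.even, mul_neg, integral_neg] at h
  linarith

/-- The variance of the noise. -/
noncomputable def variance : ℝ := ∫ x, x ^ 2 ∂g.law

lemma integrable_sq_law : Integrable (fun x : ℝ => x ^ 2) g.law := (g.memLp_id 2).integrable_sq

/-- Noise bounded away from `0` nearly attains its supremum in variance. This keeps the scale in
`exists_noise_scale` below `9/10 * σ` and leaves room for the mean within the reward bound. -/
lemma le_variance : 16 / 25 ≤ g.variance := by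
  have : ∫ _x : ℝ, (16 / 25 : ℝ) ∂g.law ≤ ∫ x, x ^ 2 ∂g.law := by
    refine integral_mono_ae (integrable_const _) g.integrable_sq_law (g.ae_abs_mem.mono ?_)
    intro x hx
    have := sq_abs x
    dsimp only
    nlinarith [hx.1]
  simpa [variance] using this

lemma variance_le_one : g.variance ≤ 1 := by
  have : ∫ x, x ^ 2 ∂g.law ≤ ∫ _x : ℝ, (1 : ℝ) ∂g.law := by
    refine integral_mono_ae g.integrable_sq_law (integrable_const _) (g.ae_abs_mem.mono ?_)
    intro x hx
    have := sq_abs x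
    dsimp only
    nlinarith [hx.1, hx.2]
  simpa [variance] using this

/-- The Hellinger affinity of the noise density and its translate by `v`. -/
noncomputable def affinity (v : ℝ) : ℝ := ∫ x, g.toFun x * g.toFun (x - v)

lemma affinity_nonneg (v : ℝ) : 0 ≤ g.affinity v :=
  integral_nonneg fun x => mul_nonneg (g.nonneg x) (g.nonneg _)

lemma integrable_mul_translate (v : ℝ) : Integrable fun x => g.toFun x * g.toFun (x - v) :=
  integrable_mul_of_hasCompactSupport g.continuous_toFun g.hasCompactSupport
    (g.continuous_toFun.comp (continuous_sub_right v))

lemma affinity_le_one (v : ℝ) : g.affinity v ≤ 1 := by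
  have h2 : ∫ x, g.toFun (x - v) ^ 2 = 1 := by
    rw [integral_sub_right_eq_self (fun x => g.toFun x ^ 2) v]; exact g.integral_sq
  have h := integral_mono (g.integrable_mul_translate v)
    ((g.integrable_sq.add (g.integrable_sq.comp_sub_right v)).const_mul (1 / 2)) (fun x => by
      simp only [Pi.add_apply]
      nlinarith [sq_nonneg (g.toFun x - g.toFun (x - v))])
  rw [integral_const_mul] at h
  simp only [Pi.add_apply] at h
  rw [integral_add g.integrable_sq (g.integrable_sq.comp_sub_right v), g.integral_sq, h2] at h
  unfold affinity
  linarith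

end NoiseAmplitude

/-! ### Product noise and reward laws on `ℝ^d`. -/

lemma one_le_prod_add_sum {ι : Type*} (s : Finset ι) (f h : ι → ℝ) (hf0 : ∀ i, 0 ≤ f i)
    (hf1 : ∀ i, f i ≤ 1) (hh : ∀ i, 0 ≤ h i) (hfh : ∀ i, 1 ≤ f i + h i) :
    1 ≤ ∏ i ∈ s, f i + ∑ i ∈ s, h i := by
  classical
  induction s using Finset.induction_on with
  | empty => simp
  | insert a s ha ih =>
    rw [Finset.prod_insert ha, Finset.sum_insert ha]
    have h1 : ∏ i ∈ s, f i ≤ 1 := Finset.prod_le_one (fun i _ => hf0 i) fun i _ => hf1 i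
    have h2 : 0 ≤ ∑ i ∈ s, h i := Finset.sum_nonneg fun i _ => hh i
    nlinarith [hf0 a, hf1 a, hh a, hfh a]

namespace NoiseAmplitude

variable (g : NoiseAmplitude) {d : ℕ}

/-- The product amplitude on `ℝ^d`. -/
noncomputable def prodAmp (m : Fin d → ℝ) : ℝ := ∏ j, g.toFun (m j)

lemma prodAmp_nonneg (m : Fin d → ℝ) : 0 ≤ g.prodAmp m :=
  Finset.prod_nonneg fun _ _ => g.nonneg _

lemma measurable_prodAmp : Measurable (g.prodAmp (d := d)) := by
  have := g.continuous_toFun.measurable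
  unfold prodAmp
  fun_prop

/-- The law of a noise vector with independent coordinates. -/
noncomputable def vectorLaw (d : ℕ) : Measure (Fin d → ℝ) := Measure.pi fun _ => g.law

instance : IsProbabilityMeasure (g.vectorLaw d) := by unfold vectorLaw; infer_instance

lemma vectorLaw_eq_withDensity :
    g.vectorLaw d = volume.withDensity fun m => ENNReal.ofReal (g.prodAmp m ^ 2) := by
  refine Measure.pi_eq fun s hs => ?_
  have hi : ∀ i, Integrable ((s i).indicator fun x => g.toFun x ^ 2) := fun i =>
    g.integrable_sq.indicator (hs i)
  have h0 : ∀ i x, 0 ≤ (s i).indicator (fun x => g.toFun x ^ 2) x := fun i x =>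
    Set.indicator_nonneg (fun _ _ => sq_nonneg _) x
  rw [withDensity_apply _ (MeasurableSet.univ_pi hs),
    ← lintegral_indicator (MeasurableSet.univ_pi hs)]
  have e : ∀ m : Fin d → ℝ, (Set.univ.pi s).indicator (fun m => ENNReal.ofReal (g.prodAmp m ^ 2)) m
      = ENNReal.ofReal (∏ i, (s i).indicator (fun x => g.toFun x ^ 2) (m i)) := by
    intro m
    by_cases hm : m ∈ Set.univ.pi s
    · rw [Set.indicator_of_mem hm, prodAmp, ← Finset.prod_pow]
      congr 1
      refine Finset.prod_congr rfl fun i _ => ?_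
      rw [Set.indicator_of_mem (hm i trivial)]
    · rw [Set.indicator_of_notMem hm]
      obtain ⟨i, hi⟩ : ∃ i, m i ∉ s i := by simpa [Set.mem_pi] using hm
      rw [Finset.prod_eq_zero (Finset.mem_univ i) (Set.indicator_of_notMem hi _),
        ENNReal.ofReal_zero]
  simp_rw [e]
  rw [volume_pi, ← ofReal_integral_eq_lintegral_ofReal (Integrable.fintype_prod_dep hi)
    (Filter.Eventually.of_forall fun m => Finset.prod_nonneg fun i _ => h0 i _),
    integral_fintype_prod_eq_prod, ENNReal.ofReal_prod_of_nonneg fun i _ => integral_nonneg (h0 i)]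
  refine Finset.prod_congr rfl fun i _ => ?_
  rw [law, withDensity_apply _ (hs i), ← lintegral_indicator (hs i),
    ofReal_integral_eq_lintegral_ofReal (hi i) (Filter.Eventually.of_forall (h0 i))]
  refine lintegral_congr fun x => ?_
  by_cases hx : x ∈ s i <;> simp [hx]

/-- The affinity of product amplitudes is the product of the coordinate affinities, so the deficits
at most add up. -/
lemma one_le_lintegral_prodAmp_add (v : Fin d → ℝ) :
    1 ≤ (∫⁻ m, ENNReal.ofReal (g.prodAmp m * g.prodAmp (m - v)))
      + ENNReal.ofReal (g.hellingerConst * ∑ j, v j ^ 2) := by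
  have e : ∀ m : Fin d → ℝ, g.prodAmp m * g.prodAmp (m - v)
      = ∏ j, (g.toFun (m j) * g.toFun (m j - v j)) := by
    intro m; simp [prodAmp, Finset.prod_mul_distrib]
  have hi : ∀ j, Integrable fun x => g.toFun x * g.toFun (x - v j) := fun j =>
    g.integrable_mul_translate (v j)
  have h0 : ∀ j x, 0 ≤ g.toFun x * g.toFun (x - v j) := fun j x => mul_nonneg (g.nonneg _) (g.nonneg _)
  simp_rw [e]
  rw [volume_pi, ← ofReal_integral_eq_lintegral_ofReal (Integrable.fintype_prod_dep
    (f := fun j x => g.toFun x * g.toFun (x - v j)) hi)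
    (Filter.Eventually.of_forall fun m => Finset.prod_nonneg fun i _ => h0 i _),
    integral_fintype_prod_eq_prod (fun j x => g.toFun x * g.toFun (x - v j))]
  change 1 ≤ ENNReal.ofReal (∏ i, g.affinity (v i)) + _
  rw [← ENNReal.ofReal_add (Finset.prod_nonneg fun j _ => g.affinity_nonneg (v j))
      (mul_nonneg g.hellingerConst_nonneg (Finset.sum_nonneg fun j _ => sq_nonneg _)),
    ← ENNReal.ofReal_one]
  refine ENNReal.ofReal_le_ofReal ?_
  rw [Finset.mul_sum]
  exact one_le_prod_add_sum Finset.univ (fun j => g.affinity (v j)) _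
    (fun j => g.affinity_nonneg _) (fun j => g.affinity_le_one _)
    (fun j => mul_nonneg g.hellingerConst_nonneg (sq_nonneg _))
    fun j => g.one_le_affinity_add (v j)

/-- The reward law with mean `μ` whose coordinates have independent noise of scales `D`. -/
noncomputable def rewardLaw (μ D : Fin d → ℝ) : Measure (Fin d → ℝ) :=
  (g.vectorLaw d).map fun m => μ + D * m

lemma measurable_affine (μ D : Fin d → ℝ) : Measurable fun m : Fin d → ℝ => μ + D * m := by
  fun_prop

instance (μ D : Fin d → ℝ) : IsProbabilityMeasure (g.rewardLaw μ D) :=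
  Measure.isProbabilityMeasure_map (measurable_affine μ D).aemeasurable

lemma lintegral_rewardLaw (μ D : Fin d → ℝ) {Φ : (Fin d → ℝ) → ENNReal} (hΦ : Measurable Φ) :
    ∫⁻ θ, Φ θ ∂g.rewardLaw μ D
      = ∫⁻ m, ENNReal.ofReal (g.prodAmp m ^ 2) * Φ (μ + D * m) := by
  rw [rewardLaw, lintegral_map hΦ (measurable_affine μ D), vectorLaw_eq_withDensity,
    lintegral_withDensity_eq_lintegral_mul _ (by have := g.measurable_prodAmp (d := d); fun_prop)
      (g := fun m => Φ (μ + D * m)) (hΦ.comp (measurable_affine μ D))]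
  rfl

lemma ae_abs_vectorLaw_le : ∀ᵐ m ∂g.vectorLaw d, ∀ j, |m j| ≤ 1 := by
  rw [ae_all_iff]
  intro j
  have := (measurePreserving_eval (fun _ : Fin d => g.law) j).quasiMeasurePreserving.ae
    (g.ae_abs_mem)
  exact this.mono fun m hm => hm.2

lemma ae_abs_rewardLaw_sub_le (μ D : Fin d → ℝ) :
    ∀ᵐ θ ∂g.rewardLaw μ D, ∀ j, |θ j - μ j| ≤ |D j| := by
  rw [rewardLaw, ae_map_iff (measurable_affine μ D).aemeasurable]
  · filter_upwards [g.ae_abs_vectorLaw_le] with m hm j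
    simp only [Pi.add_apply, Pi.mul_apply, add_sub_cancel_left, abs_mul]
    exact mul_le_of_le_one_right (abs_nonneg _) (hm j)
  · simp only [Set.ofPred_forall]
    refine MeasurableSet.iInter fun j => measurableSet_le ?_ ?_ <;> fun_prop

lemma memLp_eval_vectorLaw (j : Fin d) (p : ENNReal) :
    MemLp (fun m : Fin d → ℝ => m j) p (g.vectorLaw d) :=
  MemLp.of_bound (measurable_pi_apply j).aestronglyMeasurable 1 (g.ae_abs_vectorLaw_le.mono fun _ h => h j)

lemma integral_eval_vectorLaw (j : Fin d) (f : ℝ → ℝ) (hf : Measurable f) :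
    ∫ m, f (m j) ∂g.vectorLaw d = ∫ x, f x ∂g.law := by
  have h := (measurePreserving_eval (fun _ : Fin d => g.law) j)
  rw [← h.map_eq, integral_map h.aemeasurable hf.aestronglyMeasurable]
  rfl

lemma meanVector_rewardLaw (μ D : Fin d → ℝ) : meanVector (g.rewardLaw μ D) = μ := by
  ext i
  rw [meanVector, rewardLaw, integral_map (measurable_affine μ D).aemeasurable
    (measurable_pi_apply i).aestronglyMeasurable]
  simp only [Pi.add_apply, Pi.mul_apply]
  rw [integral_add (integrable_const _)
    (((g.memLp_eval_vectorLaw i 1).integrable le_rfl).const_mul _), integral_const_mul,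
    g.integral_eval_vectorLaw i (fun x => x) measurable_id, g.integral_id_law]
  simp

lemma rewardCov_rewardLaw (μ D : Fin d → ℝ) :
    rewardCov (g.rewardLaw μ D) = Matrix.diagonal fun j => g.variance * D j ^ 2 := by
  ext i j
  have hint : ∀ i, Integrable (fun m : Fin d → ℝ => D i * m i) (g.vectorLaw d) := fun i =>
    ((g.memLp_eval_vectorLaw i 1).integrable le_rfl).const_mul _
  rw [rewardCov, Matrix.of_apply, rewardLaw,
    covariance_map_fun (measurable_pi_apply i).aestronglyMeasurable
    (measurable_pi_apply j).aestronglyMeasurable (measurable_affine μ D).aemeasurable]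
  simp only [Pi.add_apply, Pi.mul_apply]
  rw [covariance_const_add_left (hint i), covariance_const_add_right (hint j),
    covariance_const_mul_left, covariance_const_mul_right]
  rcases eq_or_ne i j with rfl | hij
  · rw [Matrix.diagonal_apply_eq, covariance_self (measurable_pi_apply i).aemeasurable, variance_eq_sub
      (g.memLp_eval_vectorLaw i 2)]
    simp only [Pi.pow_apply]
    rw [g.integral_eval_vectorLaw i (fun x => x) measurable_id, g.integral_id_law,
      g.integral_eval_vectorLaw i (fun x => x ^ 2) (by fun_prop), NoiseAmplitude.variance]
    ring
  · rw [Matrix.diagonal_apply_ne _ hij]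
    have hind : iIndepFun (fun (j : Fin d) (m : Fin d → ℝ) => m j) (g.vectorLaw d) :=
      iIndepFun_pi (X := fun _ x => x) fun _ => aemeasurable_id
    rw [(hind.indepFun hij).covariance_eq_zero (g.memLp_eval_vectorLaw i 2)
      (g.memLp_eval_vectorLaw j 2)]
    simp

lemma actionVariance_rewardLaw (μ D a : Fin d → ℝ) :
    actionVariance (g.rewardLaw μ D) a = g.variance * ∑ j, D j ^ 2 * a j ^ 2 := by
  rw [actionVariance, rewardCov_rewardLaw, dotProduct, Finset.mul_sum]
  refine Finset.sum_congr rfl fun j _ => ?_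
  rw [Matrix.mulVec_diagonal]
  ring

end NoiseAmplitude

/-! ### Measurability of the history and its independence of the current reward vector. -/

namespace BanditAlgorithm

variable {d : ℕ} {A : Set (Fin d → ℝ)} (alg : BanditAlgorithm d A)

lemma measurable_snoc {n : ℕ} {Z : Type*} [MeasurableSpace Z] {f : Z → Fin n → ℝ} {h : Z → ℝ}
    (hf : Measurable f) (hh : Measurable h) :
    Measurable fun z => (Fin.snoc (f z) (h z) : Fin (n + 1) → ℝ) := by
  refine measurable_pi_iff.2 fun i => ?_
  refine Fin.lastCases ?_ (fun j => ?_) i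
  · simpa using hh
  · simpa [Function.comp_def] using (measurable_pi_apply j).comp hf

lemma measurable_dotProduct {Z : Type*} [MeasurableSpace Z] {f h : Z → Fin d → ℝ}
    (hf : Measurable f) (hh : Measurable h) : Measurable fun z => f z ⬝ᵥ h z := by
  unfold dotProduct
  fun_prop

lemma measurable_rewards (t : ℕ) :
    Measurable fun x : alg.Seed × (ℕ → Fin d → ℝ) => alg.rewards x.1 x.2 t := by
  induction t with
  | zero => exact measurable_pi_iff.2 fun i => i.elim0
  | succ t ih =>
    simp only [rewards]
    refine measurable_snoc ih (measurable_dotProduct ?_ ?_)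
    · exact (alg.measurable_act t).comp (measurable_fst.prodMk ih)
    · exact (measurable_pi_apply t).comp measurable_snd

lemma measurable_action (t : ℕ) :
    Measurable fun x : alg.Seed × (ℕ → Fin d → ℝ) => alg.action x.1 x.2 t :=
  (alg.measurable_act t).comp (measurable_fst.prodMk (alg.measurable_rewards t))

lemma measurable_rewards_seed (s : alg.Seed) (t : ℕ) : Measurable fun θ => alg.rewards s θ t :=
  (alg.measurable_rewards t).comp measurable_prodMk_left

lemma measurable_action_seed (s : alg.Seed) (t : ℕ) : Measurable fun θ => alg.action s θ t :=
  (alg.measurable_action t).comp measurable_prodMk_left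

lemma measurable_act_seed (s : alg.Seed) (t : ℕ) : Measurable fun x => alg.act t s x :=
  (alg.measurable_act t).comp measurable_prodMk_left

lemma rewards_congr (s : alg.Seed) {θ θ' : ℕ → Fin d → ℝ} (t : ℕ)
    (h : ∀ i < t, θ i = θ' i) : alg.rewards s θ t = alg.rewards s θ' t := by
  induction t with
  | zero => rfl
  | succ t ih =>
    simp only [rewards, ih fun i hi => h i (hi.trans t.lt_succ_self), h t t.lt_succ_self]

lemma indepFun_rewards (s : alg.Seed) (ν : Measure (Fin d → ℝ)) [IsProbabilityMeasure ν] (t : ℕ) :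
    IndepFun (fun θ => alg.rewards s θ t) (fun θ => θ t) (Measure.infinitePi fun _ : ℕ => ν) := by
  have hind : iIndepFun (fun (i : ℕ) (θ : ℕ → Fin d → ℝ) => θ i)
      (Measure.infinitePi fun _ : ℕ => ν) :=
    iIndepFun_infinitePi (X := fun _ x => x) fun _ => measurable_id
  have h := hind.indepFun_finset (Finset.range t) {t} (by simp) fun i => measurable_pi_apply i
  -- Padding by `0` is harmless, because the first `t` rewards depend only on `θ i` with `i < t`.
  let ext : (Finset.range t → Fin d → ℝ) → ℕ → Fin d → ℝ := fun r i =>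
    if hi : i ∈ Finset.range t then r ⟨i, hi⟩ else 0
  have hext : Measurable ext := by
    refine measurable_pi_iff.2 fun i => ?_
    by_cases hi : i ∈ Finset.range t
    · simpa only [ext, hi, dif_pos] using measurable_pi_apply _
    · simpa only [ext, hi, dif_neg, not_false_eq_true] using measurable_const
  have hψ : Measurable fun r : ({t} : Finset ℕ) → Fin d → ℝ =>
      r ⟨t, Finset.mem_singleton_self t⟩ := measurable_pi_apply _
  have h2 := h.comp (φ := fun r => alg.rewards s (ext r) t)
    ((alg.measurable_rewards_seed s t).comp hext) hψ
  convert h2 using 1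
  · ext1 θ
    refine alg.rewards_congr s t fun i hi => ?_
    simp [ext, hi]
  · rfl

lemma lintegral_rewards_prod (s : alg.Seed) (ν : Measure (Fin d → ℝ)) [IsProbabilityMeasure ν]
    (t : ℕ) {Ψ : (Fin t → ℝ) × (Fin d → ℝ) → ENNReal} (hΨ : Measurable Ψ) :
    ∫⁻ θ, Ψ (alg.rewards s θ t, θ t) ∂(Measure.infinitePi fun _ : ℕ => ν)
      = ∫⁻ θ, ∫⁻ y, Ψ (alg.rewards s θ t, y) ∂ν ∂(Measure.infinitePi fun _ : ℕ => ν) := by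
  have hm := alg.measurable_rewards_seed s t
  have h := (indepFun_iff_map_prod_eq_prod_map_map hm.aemeasurable
    (measurable_pi_apply t).aemeasurable).1 (alg.indepFun_rewards s ν t)
  rw [← lintegral_map hΨ (hm.prodMk (measurable_pi_apply t)), h, Measure.infinitePi_map_eval,
    lintegral_prod _ hΨ.aemeasurable, lintegral_map hΨ.lintegral_prod_right' hm]

/-! ### Signal-to-noise ratios and the Hellinger affinity of two histories. -/

/-- The signal-to-noise ratio of the action `a` for telling apart two mean vectors which differ by
`δ`, when the noise has scales `D`. -/
noncomputable def snr (δ D a : Fin d → ℝ) : ℝ := (a ⬝ᵥ δ) ^ 2 / ∑ j, D j ^ 2 * a j ^ 2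

lemma snr_nonneg (δ D a : Fin d → ℝ) : 0 ≤ snr δ D a :=
  div_nonneg (sq_nonneg _) (Finset.sum_nonneg fun _ _ => by positivity)

lemma measurable_snr (δ D : Fin d → ℝ) : Measurable (snr δ D) := by
  unfold snr
  have := measurable_dotProduct (Z := Fin d → ℝ) measurable_id (measurable_const (a := δ))
  fun_prop

/-- Cauchy–Schwarz for `δ / D` and `D * a`. It makes `snr` bounded, hence integrable, and is itself
the information bound in dimension one. -/
lemma snr_le (δ D a : Fin d → ℝ) (hD : ∀ j, D j ≠ 0) : snr δ D a ≤ ∑ j, (δ j / D j) ^ 2 := by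
  refine div_le_of_le_mul₀ (Finset.sum_nonneg fun _ _ => by positivity)
    (Finset.sum_nonneg fun _ _ => by positivity) ?_
  have h := Finset.sum_mul_sq_le_sq_mul_sq Finset.univ (fun j => δ j / D j) (fun j => D j * a j)
  have e : ∑ j, δ j / D j * (D j * a j) = a ⬝ᵥ δ := by
    refine Finset.sum_congr rfl fun j _ => ?_
    have := hD j
    field_simp
  simpa only [e, mul_pow] using h

/-- The shift of the noise vector which has the same effect on the reward of the action `a` as a
change by `δ` of the mean vector. -/
noncomputable def noiseShift (δ D a : Fin d → ℝ) : Fin d → ℝ := fun j =>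
  D j * a j * (a ⬝ᵥ δ) / ∑ j, D j ^ 2 * a j ^ 2

lemma measurable_noiseShift (δ D : Fin d → ℝ) : Measurable (noiseShift δ D) := by
  unfold noiseShift
  have := measurable_dotProduct (Z := Fin d → ℝ) measurable_id (measurable_const (a := δ))
  fun_prop

lemma sum_noiseShift_sq (δ D a : Fin d → ℝ) : ∑ j, noiseShift δ D a j ^ 2 = snr δ D a := by
  simp only [noiseShift, snr, div_pow, mul_pow]
  rw [← Finset.sum_div, ← Finset.sum_mul]
  rcases eq_or_ne (∑ j, D j ^ 2 * a j ^ 2) 0 with h | h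
  · simp [h]
  · field_simp

lemma dotProduct_noiseShift (δ D a : Fin d → ℝ) (hD : ∀ j, D j ≠ 0) :
    a ⬝ᵥ (D * noiseShift δ D a) = a ⬝ᵥ δ := by
  have e : a ⬝ᵥ (D * noiseShift δ D a)
      = (∑ j, D j ^ 2 * a j ^ 2) * ((a ⬝ᵥ δ) / ∑ j, D j ^ 2 * a j ^ 2) := by
    rw [dotProduct, Finset.sum_mul]
    refine Finset.sum_congr rfl fun j _ => ?_
    simp only [Pi.mul_apply, noiseShift]
    ring
  rw [e]
  rcases eq_or_ne (∑ j, D j ^ 2 * a j ^ 2) 0 with h | h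
  -- Division by zero gives `0` here, and this is the right value since nonzero scales force `a =
  -- 0`.
  · have : a = 0 := by
      ext j
      have := (Finset.sum_eq_zero_iff_of_nonneg fun j _ => by positivity).1 h j (Finset.mem_univ j)
      simpa [hD j] using this
    simp [this]
  · field_simp

lemma lintegral_rewards_succ (s : alg.Seed) (ν : Measure (Fin d → ℝ)) [IsProbabilityMeasure ν]
    (t : ℕ) {Φ : (Fin (t + 1) → ℝ) → ENNReal} (hΦ : Measurable Φ) :
    ∫⁻ θ, Φ (alg.rewards s θ (t + 1)) ∂(Measure.infinitePi fun _ : ℕ => ν)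
      = ∫⁻ θ, ∫⁻ y, Φ (Fin.snoc (alg.rewards s θ t) (alg.act t s (alg.rewards s θ t) ⬝ᵥ y)) ∂ν
        ∂(Measure.infinitePi fun _ : ℕ => ν) :=
  alg.lintegral_rewards_prod s ν t (Ψ := fun x => Φ (Fin.snoc x.1 (alg.act t s x.1 ⬝ᵥ x.2)))
    (hΦ.comp (measurable_snoc measurable_fst (measurable_dotProduct
      ((alg.measurable_act_seed s t).comp measurable_fst) measurable_snd)))

variable (g : NoiseAmplitude)

/-- A common latent space for the reward histories under two mean vectors, with amplitudes `α`, `β`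
whose Hellinger affinity is controlled by the accumulated signal-to-noise ratio. -/
lemma exists_latent_amplitudes (s : alg.Seed) (μ μ' D : Fin d → ℝ) (hD : ∀ j, D j ≠ 0) (t : ℕ) :
    ∃ (X : Type) (_ : MeasurableSpace X) (ρ : Measure X) (_ : SFinite ρ) (R : X → Fin t → ℝ)
      (α β : X → ℝ), Measurable R ∧ Measurable α ∧ Measurable β ∧ (∀ x, 0 ≤ α x) ∧ (∀ x, 0 ≤ β x) ∧
      (∀ Φ : (Fin t → ℝ) → ENNReal, Measurable Φ →
        ∫⁻ θ, Φ (alg.rewards s θ t) ∂(Measure.infinitePi fun _ : ℕ => g.rewardLaw μ D)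
          = ∫⁻ x, ENNReal.ofReal (α x ^ 2) * Φ (R x) ∂ρ) ∧
      (∀ Φ : (Fin t → ℝ) → ENNReal, Measurable Φ →
        ∫⁻ θ, Φ (alg.rewards s θ t) ∂(Measure.infinitePi fun _ : ℕ => g.rewardLaw μ' D)
          = ∫⁻ x, ENNReal.ofReal (β x ^ 2) * Φ (R x) ∂ρ) ∧
      1 ≤ (∫⁻ x, ENNReal.ofReal (α x * β x) ∂ρ) + ∑ r ∈ Finset.range t,
        ((∫⁻ θ, ENNReal.ofReal (g.hellingerConst / 2 * snr (μ' - μ) D (alg.action s θ r))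
            ∂(Measure.infinitePi fun _ : ℕ => g.rewardLaw μ D))
          + ∫⁻ θ, ENNReal.ofReal (g.hellingerConst / 2 * snr (μ' - μ) D (alg.action s θ r))
            ∂(Measure.infinitePi fun _ : ℕ => g.rewardLaw μ' D)) := by
  induction t with
  | zero =>
    refine ⟨Unit, inferInstance, Measure.dirac (), inferInstance, fun _ => Fin.elim0, fun _ => 1,
      fun _ => 1, measurable_const, measurable_const, measurable_const, by simp, by simp, ?_, ?_,
      by simp⟩ <;>
    · intro Φ hΦ
      simp [rewards]
  | succ t ih =>
    obtain ⟨X, _, ρ, _, R, α, β, hR, hα, hβ, hα0, hβ0, hP, hQ, hH⟩ := ih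
    have hG := g.measurable_prodAmp (d := d)
    -- The shift may depend on the past, since the action of this round is already determined by the
    -- history `R x` and the seed.
    let v : X → Fin d → ℝ := fun x => noiseShift (μ' - μ) D (alg.act t s (R x))
    have hact := alg.measurable_act_seed s t
    have hv : Measurable v := (measurable_noiseShift _ _).comp (hact.comp hR)
    have hR' : Measurable fun z : X × (Fin d → ℝ) =>
        (Fin.snoc (R z.1) (alg.act t s (R z.1) ⬝ᵥ (μ + D * z.2)) : Fin (t + 1) → ℝ) :=
      measurable_snoc (hR.comp measurable_fst) (measurable_dotProduct
        (hact.comp (hR.comp measurable_fst)) (by fun_prop))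
    have hα' : Measurable fun z : X × (Fin d → ℝ) => α z.1 * g.prodAmp z.2 := by fun_prop
    have hβ' : Measurable fun z : X × (Fin d → ℝ) => β z.1 * g.prodAmp (z.2 - v z.1) := by fun_prop
    have hsn : ∀ (h : Fin t → ℝ) (Φ : (Fin (t + 1) → ℝ) → ENNReal), Measurable Φ →
        Measurable fun y => Φ (Fin.snoc h (alg.act t s h ⬝ᵥ y)) := fun h Φ hΦ =>
      hΦ.comp (measurable_snoc measurable_const
        (measurable_dotProduct measurable_const measurable_id))
    have hsn2 : ∀ (ν : Measure (Fin d → ℝ)) [IsProbabilityMeasure ν]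
        (Φ : (Fin (t + 1) → ℝ) → ENNReal), Measurable Φ →
        Measurable fun h : Fin t → ℝ => ∫⁻ y, Φ (Fin.snoc h (alg.act t s h ⬝ᵥ y)) ∂ν :=
      fun ν _ Φ hΦ => Measurable.lintegral_prod_right' (f := fun x : (Fin t → ℝ) × (Fin d → ℝ) =>
        Φ (Fin.snoc x.1 (alg.act t s x.1 ⬝ᵥ x.2)))
        (hΦ.comp (measurable_snoc measurable_fst (measurable_dotProduct
        (hact.comp measurable_fst) measurable_snd)))
    refine ⟨X × (Fin d → ℝ), inferInstance, ρ.prod volume, inferInstance,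
      fun z => Fin.snoc (R z.1) (alg.act t s (R z.1) ⬝ᵥ (μ + D * z.2)),
      fun z => α z.1 * g.prodAmp z.2, fun z => β z.1 * g.prodAmp (z.2 - v z.1), hR', hα', hβ',
      fun z => mul_nonneg (hα0 _) (g.prodAmp_nonneg _),
      fun z => mul_nonneg (hβ0 _) (g.prodAmp_nonneg _), fun Φ hΦ => ?_, fun Φ hΦ => ?_, ?_⟩
    · rw [alg.lintegral_rewards_succ s _ t hΦ, hP _ (hsn2 _ Φ hΦ),
        lintegral_prod _ (by fun_prop)]
      refine lintegral_congr fun x => ?_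
      rw [g.lintegral_rewardLaw μ D (hsn (R x) Φ hΦ), ← lintegral_const_mul' _ _ (by simp)]
      refine lintegral_congr fun m => ?_
      rw [mul_pow, ENNReal.ofReal_mul (sq_nonneg _), mul_assoc]
    · rw [alg.lintegral_rewards_succ s _ t hΦ, hQ _ (hsn2 _ Φ hΦ),
        lintegral_prod _ (by fun_prop)]
      refine lintegral_congr fun x => ?_
      rw [g.lintegral_rewardLaw μ' D (hsn (R x) Φ hΦ), ← lintegral_const_mul' _ _ (by simp),
        ← lintegral_sub_right_eq_self _ (v x)]
      refine lintegral_congr fun m => ?_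
      -- After translating the integration variable, the shifted noise under `μ'` produces the same
      -- reward as `m` under `μ`. So one history map `R` serves both laws.
      have e : alg.act t s (R x) ⬝ᵥ (μ' + D * (m - v x)) = alg.act t s (R x) ⬝ᵥ (μ + D * m) := by
        have := dotProduct_noiseShift (μ' - μ) D (alg.act t s (R x)) hD
        rw [dotProduct_sub] at this
        rw [mul_sub, dotProduct_add, dotProduct_sub, dotProduct_add, this]
        ring
      rw [e, mul_pow, ENNReal.ofReal_mul (sq_nonneg _), mul_assoc]
    · rw [Finset.sum_range_succ, lintegral_prod _ (by fun_prop)]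
      set h : (Fin t → ℝ) → ENNReal := fun y =>
        ENNReal.ofReal (g.hellingerConst / 2 * snr (μ' - μ) D (alg.act t s y)) with hh
      have hhm : Measurable h := by
        have := (measurable_snr (μ' - μ) D).comp hact
        exact ENNReal.measurable_ofReal.comp (this.const_mul _)
      -- The affinity lost in this round is at most `αβ` times `hellingerConst * snr`; then `αβ ≤
      -- (α² + β²)/2` turns the loss into expectations under the two laws.
      have e1 : ∫⁻ x, ENNReal.ofReal (α x * β x) ∂ρ
          ≤ (∫⁻ x, (∫⁻ m, ENNReal.ofReal (α x * g.prodAmp m * (β x * g.prodAmp (m - v x)))) ∂ρ)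
            + ((∫⁻ x, ENNReal.ofReal (α x ^ 2) * h (R x) ∂ρ)
              + ∫⁻ x, ENNReal.ofReal (β x ^ 2) * h (R x) ∂ρ) := by
        have hm1 : Measurable fun x => ENNReal.ofReal (α x ^ 2) * h (R x) := by fun_prop
        have hm2 : Measurable fun x => ENNReal.ofReal (β x ^ 2) * h (R x) := by fun_prop
        have hm12 : Measurable fun x =>
            ENNReal.ofReal (α x ^ 2) * h (R x) + ENNReal.ofReal (β x ^ 2) * h (R x) := hm1.add hm2
        rw [← lintegral_add_left hm1, ← lintegral_add_right _ hm12]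
        refine lintegral_mono fun x => ?_
        have hab : 0 ≤ α x * β x := mul_nonneg (hα0 x) (hβ0 x)
        have hsnr := snr_nonneg (μ' - μ) D (alg.act t s (R x))
        have hL := g.hellingerConst_nonneg
        calc ENNReal.ofReal (α x * β x)
            ≤ ENNReal.ofReal (α x * β x) *
              ((∫⁻ m, ENNReal.ofReal (g.prodAmp m * g.prodAmp (m - v x)))
                + ENNReal.ofReal (g.hellingerConst * ∑ j, v x j ^ 2)) :=
              le_mul_of_one_le_right zero_le (g.one_le_lintegral_prodAmp_add (v x))
          _ = (∫⁻ m, ENNReal.ofReal (α x * g.prodAmp m * (β x * g.prodAmp (m - v x))))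
              + ENNReal.ofReal (α x * β x) * ENNReal.ofReal (g.hellingerConst *
                snr (μ' - μ) D (alg.act t s (R x))) := by
              rw [mul_add, ← lintegral_const_mul' _ _ (by simp), sum_noiseShift_sq]
              congr 1
              refine lintegral_congr fun m => ?_
              rw [← ENNReal.ofReal_mul hab]
              congr 1; ring
          _ ≤ _ := by
              refine add_le_add_right ?_ _
              rw [hh]
              dsimp only
              rw [← ENNReal.ofReal_mul hab, ← ENNReal.ofReal_mul (sq_nonneg _),
                ← ENNReal.ofReal_mul (sq_nonneg _),
                ← ENNReal.ofReal_add (by positivity) (by positivity)]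
              refine ENNReal.ofReal_le_ofReal ?_
              have h0 : 0 ≤ g.hellingerConst * snr (μ' - μ) D (alg.act t s (R x)) := by positivity
              nlinarith [mul_nonneg h0 (sq_nonneg (α x - β x))]
      rw [← hP h hhm, ← hQ h hhm] at e1
      refine hH.trans ((add_le_add_left e1 _).trans (le_of_eq ?_))
      rw [add_assoc]
      congr 1
      rw [add_comm]
      rfl

end BanditAlgorithm

/-! ### Comparing expectations of a function of the action in two environments. -/

namespace BanditAlgorithm

variable {d : ℕ} {A : Set (Fin d → ℝ)} (alg : BanditAlgorithm d A) (g : NoiseAmplitude)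

/-- The expectation of `f (a_t)` when the seed is fixed to `s` and the reward vectors are i.i.d.
with law `ν`. -/
noncomputable def actionMean (s : alg.Seed) (ν : Measure (Fin d → ℝ)) [IsProbabilityMeasure ν]
    (t : ℕ) (f : (Fin d → ℝ) → ℝ) : ℝ :=
  ∫ θ, f (alg.action s θ t) ∂(Measure.infinitePi fun _ : ℕ => ν)

lemma integrable_comp_action (s : alg.Seed) (ν : Measure (Fin d → ℝ)) [IsProbabilityMeasure ν]
    (t : ℕ) {f : (Fin d → ℝ) → ℝ} (hf : Measurable f) {B : ℝ} (hB : ∀ a ∈ A, |f a| ≤ B) :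
    Integrable (fun θ => f (alg.action s θ t)) (Measure.infinitePi fun _ : ℕ => ν) :=
  Integrable.of_bound (hf.comp (alg.measurable_action_seed s t)).aestronglyMeasurable B
    (Filter.Eventually.of_forall fun _ => hB _ (alg.act_mem _ _ _))

lemma ofReal_actionMean (s : alg.Seed) (ν : Measure (Fin d → ℝ)) [IsProbabilityMeasure ν]
    (t : ℕ) {f : (Fin d → ℝ) → ℝ} (hf : Measurable f) {B : ℝ} (hB : ∀ a ∈ A, |f a| ≤ B)
    (h0 : ∀ a, 0 ≤ f a) :
    ENNReal.ofReal (alg.actionMean s ν t f)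
      = ∫⁻ θ, ENNReal.ofReal (f (alg.action s θ t)) ∂(Measure.infinitePi fun _ : ℕ => ν) :=
  ofReal_integral_eq_lintegral_ofReal (alg.integrable_comp_action s ν t hf hB)
    (Filter.Eventually.of_forall fun _ => h0 _)

lemma actionMean_nonneg (s : alg.Seed) (ν : Measure (Fin d → ℝ)) [IsProbabilityMeasure ν]
    (t : ℕ) {f : (Fin d → ℝ) → ℝ} (h0 : ∀ a, 0 ≤ f a) : 0 ≤ alg.actionMean s ν t f :=
  integral_nonneg fun _ => h0 _

/-- Change of variables for a law which is represented by a squared amplitude. -/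
lemma integral_eq_of_lintegral_eq {Ω X H : Type*} [MeasurableSpace Ω] [MeasurableSpace X]
    [MeasurableSpace H] {P : Measure Ω} [IsProbabilityMeasure P] {ρ : Measure X} {Y : Ω → H}
    {R : X → H} {α : X → ℝ} (hY : Measurable Y) (hR : Measurable R) (hα : Measurable α)
    (h : ∀ Φ : H → ENNReal, Measurable Φ →
      ∫⁻ ω, Φ (Y ω) ∂P = ∫⁻ x, ENNReal.ofReal (α x ^ 2) * Φ (R x) ∂ρ) :
    Integrable (fun x => α x ^ 2) ρ ∧ ∀ ψ : H → ℝ, Measurable ψ →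
      ∫ ω, ψ (Y ω) ∂P = ∫ x, α x ^ 2 * ψ (R x) ∂ρ := by
  have hd : Measurable fun x => ENNReal.ofReal (α x ^ 2) := by fun_prop
  have hone : ∫⁻ x, ENNReal.ofReal (α x ^ 2) ∂ρ = 1 := by
    simpa using (h (fun _ => 1) measurable_const).symm
  have hmap : P.map Y = (ρ.withDensity fun x => ENNReal.ofReal (α x ^ 2)).map R := by
    ext S hS
    have e := h (S.indicator 1) (measurable_one.indicator hS)
    rw [← lintegral_map (measurable_one.indicator hS) hY, lintegral_indicator_one hS] at e
    rw [e, ← lintegral_indicator_one hS, lintegral_map (measurable_one.indicator hS) hR,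
      lintegral_withDensity_eq_lintegral_mul _ hd (g := fun x => S.indicator 1 (R x))
        ((measurable_one.indicator hS).comp hR)]
    rfl
  refine ⟨⟨(hα.pow_const 2).aestronglyMeasurable, ?_⟩, fun ψ hψ => ?_⟩
  · rw [hasFiniteIntegral_iff_ofReal (Filter.Eventually.of_forall fun x => sq_nonneg _), hone]
    exact ENNReal.one_lt_top
  · rw [← integral_map hY.aemeasurable hψ.aestronglyMeasurable, hmap,
      integral_map hR.aemeasurable hψ.aestronglyMeasurable,
      integral_withDensity_eq_integral_toReal_smul hd (by simp)]
    simp [ENNReal.toReal_ofReal, sq_nonneg]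

/-- The mean of a function of the action cannot differ much between two environments which are hard
to tell apart. -/
theorem actionMean_sub_le (s : alg.Seed) (μ μ' D : Fin d → ℝ) (hD : ∀ j, D j ≠ 0) (t : ℕ)
    {f : (Fin d → ℝ) → ℝ} (hf : Measurable f) {B : ℝ} (hB : ∀ a ∈ A, |f a| ≤ B) {l : ℝ}
    (hl : 0 < l) :
    alg.actionMean s (g.rewardLaw μ D) t f - alg.actionMean s (g.rewardLaw μ' D) t f
      ≤ l * (alg.actionMean s (g.rewardLaw μ D) t (fun a => f a ^ 2)
          + alg.actionMean s (g.rewardLaw μ' D) t (fun a => f a ^ 2))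
        + g.hellingerConst / (2 * l) * ∑ r ∈ Finset.range t,
          (alg.actionMean s (g.rewardLaw μ D) r (snr (μ' - μ) D)
            + alg.actionMean s (g.rewardLaw μ' D) r (snr (μ' - μ) D)) := by
  obtain ⟨X, _, ρ, _, R, α, β, hR, hα, hβ, hα0, hβ0, hP, hQ, hH⟩ :=
    alg.exists_latent_amplitudes g s μ μ' D hD t
  have hY := alg.measurable_rewards_seed s t
  obtain ⟨iα, eα⟩ := integral_eq_of_lintegral_eq hY hR hα hP
  obtain ⟨iβ, eβ⟩ := integral_eq_of_lintegral_eq hY hR hβ hQ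
  have hL := g.hellingerConst_nonneg
  set snr' := snr (μ' - μ) D with hsnr'
  set S := ∑ r ∈ Finset.range t, (alg.actionMean s (g.rewardLaw μ D) r snr'
            + alg.actionMean s (g.rewardLaw μ' D) r snr') with hS
  have iαβ : Integrable (fun x => α x * β x) ρ := by
    refine Integrable.mono' (iα.add iβ) (hα.mul hβ).aestronglyMeasurable
      (Filter.Eventually.of_forall fun x => ?_)
    rw [Real.norm_of_nonneg (mul_nonneg (hα0 x) (hβ0 x))]
    simp only [Pi.add_apply]
    nlinarith [sq_nonneg (α x - β x), sq_nonneg (α x + β x)]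
  have hone : ∫ x, α x ^ 2 ∂ρ = 1 := by simpa using (eα (fun _ => 1) measurable_const).symm
  have hone' : ∫ x, β x ^ 2 ∂ρ = 1 := by simpa using (eβ (fun _ => 1) measurable_const).symm
  have haff : 1 ≤ (∫ x, α x * β x ∂ρ) + g.hellingerConst / 2 * S := by
    have hm : Measurable fun a => g.hellingerConst / 2 * snr' a :=
      (measurable_snr _ _).const_mul _
    have hbd : ∀ a ∈ A, |g.hellingerConst / 2 * snr' a|
        ≤ g.hellingerConst / 2 * ∑ j, ((μ' - μ) j / D j) ^ 2 := by
      intro a _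
      rw [abs_of_nonneg (mul_nonneg (by positivity) (snr_nonneg _ _ _))]
      exact mul_le_mul_of_nonneg_left (snr_le _ _ _ hD) (by positivity)
    have h0 : ∀ a, 0 ≤ g.hellingerConst / 2 * snr' a := fun a =>
      mul_nonneg (by positivity) (snr_nonneg _ _ _)
    rw [← ofReal_integral_eq_lintegral_ofReal iαβ
      (Filter.Eventually.of_forall fun x => mul_nonneg (hα0 x) (hβ0 x))] at hH
    have e : ∀ ν : Measure (Fin d → ℝ), ∀ [IsProbabilityMeasure ν], ∀ r,
        ∫⁻ θ, ENNReal.ofReal (g.hellingerConst / 2 * snr' (alg.action s θ r))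
          ∂(Measure.infinitePi fun _ : ℕ => ν)
        = ENNReal.ofReal (g.hellingerConst / 2 * alg.actionMean s ν r snr') := by
      intro ν _ r
      rw [← alg.ofReal_actionMean s ν r hm hbd h0, actionMean, integral_const_mul, actionMean]
    simp only [e] at hH
    have hn : ∀ (ν : Measure (Fin d → ℝ)) [IsProbabilityMeasure ν], ∀ r,
        0 ≤ g.hellingerConst / 2 * alg.actionMean s ν r snr' := fun ν _ r =>
      mul_nonneg (by positivity) (alg.actionMean_nonneg s ν r (snr_nonneg _ _))
    simp only [← ENNReal.ofReal_add (hn _ _) (hn _ _)] at hH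
    rw [← ENNReal.ofReal_sum_of_nonneg fun r _ => add_nonneg (hn _ _) (hn _ _),
      ← ENNReal.ofReal_add (integral_nonneg fun x => mul_nonneg (hα0 x) (hβ0 x))
        (Finset.sum_nonneg fun r _ => add_nonneg (hn _ _) (hn _ _)), ← ENNReal.ofReal_one,
      ENNReal.ofReal_le_ofReal_iff] at hH
    · simpa only [hS, Finset.mul_sum, mul_add] using hH
    · exact add_nonneg (integral_nonneg fun x => mul_nonneg (hα0 x) (hβ0 x))
        (Finset.sum_nonneg fun r _ => add_nonneg (hn _ _) (hn _ _))
  set ψ : (Fin t → ℝ) → ℝ := fun h => f (alg.act t s h) with hψ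
  have hψm : Measurable ψ := hf.comp (alg.measurable_act_seed s t)
  have hψB : ∀ h, |ψ h| ≤ B := fun h => hB _ (alg.act_mem _ _ _)
  have e1 : alg.actionMean s (g.rewardLaw μ D) t f = ∫ x, α x ^ 2 * ψ (R x) ∂ρ := eα ψ hψm
  have e2 : alg.actionMean s (g.rewardLaw μ' D) t f = ∫ x, β x ^ 2 * ψ (R x) ∂ρ := eβ ψ hψm
  have e3 : alg.actionMean s (g.rewardLaw μ D) t (fun a => f a ^ 2)
      = ∫ x, α x ^ 2 * ψ (R x) ^ 2 ∂ρ := eα (fun h => ψ h ^ 2) (hψm.pow_const 2)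
  have e4 : alg.actionMean s (g.rewardLaw μ' D) t (fun a => f a ^ 2)
      = ∫ x, β x ^ 2 * ψ (R x) ^ 2 ∂ρ := eβ (fun h => ψ h ^ 2) (hψm.pow_const 2)
  have hψR : Measurable fun x => ψ (R x) := hψm.comp hR
  have i1 : ∀ {γ : X → ℝ}, Integrable (fun x => γ x ^ 2) ρ →
      Integrable (fun x => γ x ^ 2 * ψ (R x)) ρ := fun h =>
    h.mul_bdd (c := B) hψR.aestronglyMeasurable (Filter.Eventually.of_forall fun x => hψB _)
  have i2 : ∀ {γ : X → ℝ}, Integrable (fun x => γ x ^ 2) ρ →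
      Integrable (fun x => γ x ^ 2 * ψ (R x) ^ 2) ρ := fun h =>
    h.mul_bdd (c := B ^ 2) (hψR.pow_const 2).aestronglyMeasurable
      (Filter.Eventually.of_forall fun x => by
        rw [Real.norm_eq_abs, abs_pow]
        exact pow_le_pow_left₀ (abs_nonneg _) (hψB _) 2)
  -- Factor `α² - β² = (α - β)(α + β)`, apply Young's inequality with weight `l`, and use `(α + β)²
  -- ≤ 2(α² + β²)`. The term `∫ (α - β)²` is `2 - 2 ∫ αβ`.
  have key : ∫ x, (α x ^ 2 * ψ (R x) - β x ^ 2 * ψ (R x)) ∂ρ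
      ≤ ∫ x, (l * (α x ^ 2 * ψ (R x) ^ 2 + β x ^ 2 * ψ (R x) ^ 2)
        + 1 / (2 * l) * (α x ^ 2 + β x ^ 2 - 2 * (α x * β x))) ∂ρ := by
    refine integral_mono ((i1 iα).sub (i1 iβ)) ((((i2 iα).add (i2 iβ)).const_mul l).add
      (((iα.add iβ).sub (iαβ.const_mul 2)).const_mul _)) fun x => ?_
    dsimp only
    set z := ψ (R x)
    have h1 : 0 ≤ l / 2 * (z * (α x - β x)) ^ 2 + 1 / (2 * l) *
        (l * (z * (α x + β x)) - (α x - β x)) ^ 2 := by positivity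
    have h2 : l * (α x ^ 2 * z ^ 2 + β x ^ 2 * z ^ 2)
        + 1 / (2 * l) * (α x ^ 2 + β x ^ 2 - 2 * (α x * β x)) - (α x ^ 2 * z - β x ^ 2 * z)
        = l / 2 * (z * (α x - β x)) ^ 2 + 1 / (2 * l) *
        (l * (z * (α x + β x)) - (α x - β x)) ^ 2 := by
      field_simp; ring
    linarith
  rw [integral_sub (i1 iα) (i1 iβ), ← e1, ← e2] at key
  have k2 : ∫ x, (l * (α x ^ 2 * ψ (R x) ^ 2 + β x ^ 2 * ψ (R x) ^ 2)
        + 1 / (2 * l) * (α x ^ 2 + β x ^ 2 - 2 * (α x * β x))) ∂ρ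
      = l * (∫ x, α x ^ 2 * ψ (R x) ^ 2 ∂ρ + ∫ x, β x ^ 2 * ψ (R x) ^ 2 ∂ρ)
        + 1 / (2 * l) * (2 - 2 * ∫ x, α x * β x ∂ρ) := by
    have j1 : Integrable (fun x => α x ^ 2 * ψ (R x) ^ 2 + β x ^ 2 * ψ (R x) ^ 2) ρ :=
      (i2 iα).add (i2 iβ)
    have j2 : Integrable (fun x => α x ^ 2 + β x ^ 2) ρ := iα.add iβ
    have j3 : Integrable (fun x => α x ^ 2 + β x ^ 2 - 2 * (α x * β x)) ρ :=
      j2.sub (iαβ.const_mul 2)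
    rw [integral_add (j1.const_mul l) (j3.const_mul _), integral_const_mul, integral_const_mul,
      integral_add (i2 iα) (i2 iβ), integral_sub j2 (iαβ.const_mul 2), integral_add iα iβ, hone,
      hone', integral_const_mul]
    norm_num
  rw [k2, ← e3, ← e4] at key
  refine key.trans (add_le_add le_rfl ?_)
  calc 1 / (2 * l) * (2 - 2 * ∫ x, α x * β x ∂ρ)
      ≤ 1 / (2 * l) * (g.hellingerConst * S) := by gcongr; linarith
    _ = _ := by ring

end BanditAlgorithm

/-! ### Geometry of the `ℓ_p` ball and the exponents. -/

section Ball

variable {p : ENNReal}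

lemma mem_lpBall_top_iff {d : ℕ} (a : Fin d → ℝ) : a ∈ lpBall d ⊤ ↔ ∀ i, |a i| ≤ 1 := by
  have h : ‖WithLp.toLp ⊤ a‖ = ‖a‖ := by
    rw [PiLp.norm_toLp]
  rw [lpBall, Set.mem_ofPred_eq, h, pi_norm_le_iff_of_nonneg zero_le_one]
  rfl

lemma mem_lpBall_iff {d : ℕ} (hp : 0 < p.toReal) (a : Fin d → ℝ) :
    a ∈ lpBall d p ↔ ∑ i, |a i| ^ p.toReal ≤ 1 := by
  rw [lpBall, Set.mem_ofPred_eq, PiLp.norm_eq_sum hp]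
  have h := Real.rpow_le_rpow_iff (x := ∑ i, |a i| ^ p.toReal) (y := 1) (z := 1 / p.toReal)
    (by positivity) zero_le_one (by positivity)
  rwa [Real.one_rpow] at h

lemma abs_le_one_of_mem_lpBall {d : ℕ} (hp : 1 ≤ p) {a : Fin d → ℝ} (ha : a ∈ lpBall d p)
    (i : Fin d) : |a i| ≤ 1 := by
  have : Fact (1 ≤ p) := ⟨hp⟩
  exact (PiLp.norm_apply_le (WithLp.toLp p a) i).trans ha

lemma isCompact_lpBall (d : ℕ) (hp : 1 ≤ p) : IsCompact (lpBall d p) := by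
  have : Fact (1 ≤ p) := ⟨hp⟩
  refine Metric.isCompact_of_isClosed_isBounded ?_ ?_
  · exact isClosed_le ((PiLp.continuous_toLp p fun _ : Fin d => ℝ).norm) continuous_const
  · refine (Metric.isBounded_closedBall (x := (0 : Fin d → ℝ)) (r := 1)).subset fun a ha => ?_
    rw [mem_closedBall_zero_iff, pi_norm_le_iff_of_nonneg zero_le_one]
    exact abs_le_one_of_mem_lpBall hp ha

lemma zero_mem_lpBall (d : ℕ) (hp : 1 ≤ p) : (0 : Fin d → ℝ) ∈ lpBall d p := by
  have : Fact (1 ≤ p) := ⟨hp⟩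
  simp [lpBall]

lemma le_one_add_rpow {z P : ℝ} (hz : 0 ≤ z) (hP : 1 ≤ P) : z ≤ 1 + z ^ P := by
  rcases le_total z 1 with h | h
  · linarith [Real.rpow_nonneg hz P]
  · have := Real.rpow_le_rpow_of_exponent_le h hP
    rw [Real.rpow_one] at this
    linarith

/-- Hölder's inequality up to the factor `2`, which comes from summing `z ≤ 1 + z^P` at `z = |a i|
d^(1/p)`. -/
lemma sum_abs_le_of_mem_lpBall {d : ℕ} (hd : 1 ≤ d) (hp : 1 ≤ p) {a : Fin d → ℝ}
    (ha : a ∈ lpBall d p) : ∑ i, |a i| ≤ 2 * (d : ℝ) ^ (1 - (p⁻¹).toReal) := by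
  have hd0 : (0 : ℝ) < d := by exact_mod_cast hd
  rcases eq_or_ne p ⊤ with rfl | htop
  · rw [mem_lpBall_top_iff] at ha
    have := Finset.sum_le_sum fun i (_ : i ∈ Finset.univ) => ha i
    simp only [Finset.sum_const, Finset.card_univ, Fintype.card_fin, nsmul_eq_mul, mul_one] at this
    simp only [ENNReal.inv_top, ENNReal.toReal_zero, sub_zero, Real.rpow_one]
    linarith
  · have hP : 1 ≤ p.toReal := by
      rw [← ENNReal.toReal_one]; exact (ENNReal.toReal_le_toReal (by simp) htop).2 hp
    have hP0 : 0 < p.toReal := by linarith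
    rw [mem_lpBall_iff hP0] at ha
    rw [ENNReal.toReal_inv]
    set P := p.toReal
    set w : ℝ := (d : ℝ) ^ P⁻¹ with hw
    have hw0 : 0 < w := Real.rpow_pos_of_pos hd0 _
    have hwP : w ^ P = d := by
      rw [hw, ← Real.rpow_mul hd0.le, inv_mul_cancel₀ hP0.ne', Real.rpow_one]
    have h1 : ∀ i, |a i| * w ≤ 1 + |a i| ^ P * d := fun i => by
      have := le_one_add_rpow (mul_nonneg (abs_nonneg (a i)) hw0.le) hP
      rwa [Real.mul_rpow (abs_nonneg _) hw0.le, hwP] at this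
    have h2 := Finset.sum_le_sum fun i (_ : i ∈ Finset.univ) => h1 i
    rw [← Finset.sum_mul, Finset.sum_add_distrib, ← Finset.sum_mul] at h2
    simp only [Finset.sum_const, Finset.card_univ, Fintype.card_fin, nsmul_eq_mul, mul_one] at h2
    rw [Real.rpow_sub hd0, Real.rpow_one, ← hw, ← mul_div_assoc, le_div_iff₀ hw0]
    nlinarith

/-- Bernoulli's inequality leaves at most `P (1 - a 0)` for the `P`-th powers of the other entries.
The tangent to the concave function `x^(2/P)` at `1` converts these to squares with a factor `2/P`,
so `P` cancels and the bound is uniform in `p`. -/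
lemma sum_sq_le_of_mem_lpBall {n : ℕ} (hp : 2 ≤ p) {a : Fin (n + 1) → ℝ}
    (ha : a ∈ lpBall (n + 1) p) {u : ℝ} (hu : 0 < u) :
    ∑ i : Fin n, a i.succ ^ 2 ≤ u ^ (2 * (p⁻¹).toReal) * (n + 2 * (1 - a 0) / u) := by
  have ha1 := abs_le_one_of_mem_lpBall (one_le_two.trans hp) ha
  have ha0 : 0 ≤ 1 - a 0 := by linarith [(abs_le.1 (ha1 0)).2]
  rcases eq_or_ne p ⊤ with rfl | htop
  · have := Finset.sum_le_sum fun (i : Fin n) (_ : i ∈ Finset.univ) =>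
      (sq_le_one_iff_abs_le_one (a i.succ)).2 (ha1 i.succ)
    simp only [Finset.sum_const, Finset.card_univ, Fintype.card_fin, nsmul_eq_mul, mul_one] at this
    simp only [ENNReal.inv_top, ENNReal.toReal_zero, mul_zero, Real.rpow_zero, one_mul]
    have : 0 ≤ 2 * (1 - a 0) / u := by positivity
    linarith
  · have hP : 2 ≤ p.toReal := by
      have := (ENNReal.toReal_le_toReal (by simp) htop).2 hp
      simpa using this
    have hP0 : 0 < p.toReal := by linarith
    rw [mem_lpBall_iff hP0, Fin.sum_univ_succ] at ha
    rw [ENNReal.toReal_inv]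
    set P := p.toReal
    have hb : 1 + P * (|a 0| - 1) ≤ |a 0| ^ P := by
      have := one_add_mul_self_le_rpow_one_add (s := |a 0| - 1) (by linarith [abs_nonneg (a 0)])
        (p := P) (by linarith)
      simpa using this
    have hs : ∑ i : Fin n, |a i.succ| ^ P ≤ P * (1 - a 0) := by
      nlinarith [le_abs_self (a 0)]
    have h1 : ∀ i : Fin n, a i.succ ^ 2 ≤ u ^ (2 * P⁻¹) * (1 + 2 / P * (|a i.succ| ^ P / u)) := by
      intro i
      set z := |a i.succ| with hz
      have hz0 : 0 ≤ z := abs_nonneg _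
      have hzP : 0 ≤ z ^ P / u := by positivity
      have h2 : (z ^ P / u) ^ (2 / P) ≤ 1 + 2 / P * (z ^ P / u - 1) := by
        have := rpow_one_add_le_one_add_mul_self (s := z ^ P / u - 1) (by linarith)
          (p := 2 / P) (by positivity) ((div_le_one hP0).2 hP)
        simpa using this
      have h3 : u ^ (2 * P⁻¹) * (z ^ P / u) ^ (2 / P) = a i.succ ^ 2 := by
        rw [Real.div_rpow (by positivity) hu.le, ← Real.rpow_mul hz0, mul_div_cancel₀ _ hP0.ne',
          ← div_eq_mul_inv, mul_div_cancel₀ _ (by positivity), Real.rpow_two, hz, sq_abs]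
      rw [← h3]
      have : 0 ≤ 2 / P := by positivity
      gcongr
      linarith
    refine (Finset.sum_le_sum fun i _ => h1 i).trans ?_
    rw [← Finset.mul_sum, Finset.sum_add_distrib, ← Finset.mul_sum, ← Finset.sum_div]
    simp only [Finset.sum_const, Finset.card_univ, Fintype.card_fin, nsmul_eq_mul, mul_one]
    gcongr
    calc 2 / P * ((∑ i : Fin n, |a i.succ| ^ P) / u) ≤ 2 / P * (P * (1 - a 0) / u) := by gcongr
      _ = 2 * (1 - a 0) / u := by field_simp

/-- As `p ≥ 2`, it suffices that `(1 - 3x/4)² + x ≤ 1` for `x = n u`, which holds exactly when `0 ≤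
x ≤ 8/9`. -/
lemma cons_mem_lpBall {n : ℕ} (hp : 2 ≤ p) {u : ℝ} (hu : 0 < u) (hnu : n * u ≤ 8 / 9)
    {e : Fin n → ℝ} (he : ∀ i, |e i| = 1) :
    (Fin.cons (1 - 3 / 4 * (n * u)) fun i => u ^ (p⁻¹).toReal * e i : Fin (n + 1) → ℝ)
      ∈ lpBall (n + 1) p := by
  have hnu0 : 0 ≤ n * u := by positivity
  have hx : ∀ r : ℝ, 0 ≤ u ^ r := fun r => Real.rpow_nonneg hu.le r
  rcases eq_or_ne p ⊤ with rfl | htop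
  · rw [mem_lpBall_top_iff]
    intro i
    refine Fin.cases ?_ (fun i => ?_) i
    · rw [Fin.cons_zero, abs_of_nonneg] <;> linarith
    · simp [he]
  · have hP : 2 ≤ p.toReal := by
      have := (ENNReal.toReal_le_toReal (by simp) htop).2 hp
      simpa using this
    have hP0 : 0 < p.toReal := by linarith
    rw [mem_lpBall_iff hP0, Fin.sum_univ_succ, ENNReal.toReal_inv]
    simp only [Fin.cons_zero, Fin.cons_succ, abs_mul, he, mul_one, abs_of_nonneg (hx _)]
    rw [abs_of_nonneg (by linarith), ← Real.rpow_mul hu.le, inv_mul_cancel₀ hP0.ne', Real.rpow_one]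
    simp only [Finset.sum_const, Finset.card_univ, Fintype.card_fin, nsmul_eq_mul]
    have := Real.rpow_le_rpow_of_exponent_ge' (x := 1 - 3 / 4 * (n * u)) (by linarith) (by linarith)
      zero_le_two hP
    rw [Real.rpow_two] at this
    nlinarith

/-- The exponents of a Hölder conjugate pair with `p > 2`. -/
lemma toReal_inv_lt_half {q : ENNReal} (hp : 2 < p) (hpq : p.HolderConjugate q) :
    (p⁻¹).toReal < 1 / 2 ∧ q.toReal = (1 - (p⁻¹).toReal)⁻¹ := by
  have h1 : p⁻¹ < 2⁻¹ := ENNReal.inv_lt_inv.2 hp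
  have h2 : (p⁻¹).toReal < (2⁻¹ : ENNReal).toReal :=
    (ENNReal.toReal_lt_toReal (h1.trans (by simp)).ne (by simp)).2 h1
  have h3 : p⁻¹ + q⁻¹ = 1 := hpq.inv_add_inv_eq_one
  have hq : q⁻¹ ≠ ⊤ := fun h => by simp [h] at h3
  have h4 : (p⁻¹).toReal + (q⁻¹).toReal = 1 := by
    rw [← ENNReal.toReal_add (h1.trans (by simp)).ne hq, h3, ENNReal.toReal_one]
  refine ⟨by simpa using h2, ?_⟩
  rw [← inv_inv q.toReal, ← ENNReal.toReal_inv]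
  congr 1
  linarith

lemma horizon_bounds {r d T : ℝ} (hr : r < 1 / 2) (hd : 1 ≤ d)
    (hT : d ^ (4 / (2 - (1 - r)⁻¹)) ≤ T) :
    d ≤ Real.sqrt T ∧ ∀ u, 0 < u → u ≤ 1 / Real.sqrt T → d ^ (1 - r) * u ^ (1 / 2 - r) ≤ 1 := by
  have hd0 : 0 < d := by linarith
  have h1 : 0 < 1 - r := by linarith
  have h2 : 0 < 1 - 2 * r := by linarith
  have he : 4 / (2 - (1 - r)⁻¹) = 2 * (2 * (1 - r) / (1 - 2 * r)) := by
    have : 2 - (1 - r)⁻¹ = (1 - 2 * r) / (1 - r) := by field_simp; ring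
    rw [this]; field_simp; norm_num
  -- The horizon condition reads `d^(2k) ≤ T`, and `k (1/2 - r) = 1 - r` makes the powers of `d`
  -- cancel below.
  set k := 2 * (1 - r) / (1 - 2 * r) with hk
  have hk1 : 1 ≤ k := by rw [hk, le_div_iff₀ h2]; linarith
  have hsq : d ^ k ≤ Real.sqrt T := by
    refine Real.le_sqrt_of_sq_le ?_
    rw [he, mul_comm, Real.rpow_mul hd0.le, Real.rpow_two] at hT
    exact hT
  have hdk : d ≤ d ^ k := by
    simpa using Real.rpow_le_rpow_of_exponent_le hd hk1
  refine ⟨hdk.trans hsq, fun u hu hle => ?_⟩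
  have h3 : u ≤ d ^ (-k) := by
    rw [Real.rpow_neg hd0.le, ← one_div]
    exact hle.trans (one_div_le_one_div_of_le (by positivity) hsq)
  calc d ^ (1 - r) * u ^ (1 / 2 - r) ≤ d ^ (1 - r) * (d ^ (-k)) ^ (1 / 2 - r) := by
        gcongr
    _ = d ^ (1 - r + -k * (1 / 2 - r)) := by rw [← Real.rpow_mul hd0.le, ← Real.rpow_add hd0]
    _ = 1 := by
        have : 1 - r + -k * (1 / 2 - r) = 0 := by 
          have : k * (1 - 2 * r) = 2 * (1 - r) := div_mul_cancel₀ _ h2.ne'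
          linarith
        rw [this, Real.rpow_zero]

end Ball

/-! ### Expected regret, selection of an environment, and normalisation of the noise. -/

namespace BanditAlgorithm

variable {d : ℕ} {A : Set (Fin d → ℝ)} (alg : BanditAlgorithm d A) (g : NoiseAmplitude)

lemma actionMean_mono (s : alg.Seed) (ν : Measure (Fin d → ℝ)) [IsProbabilityMeasure ν] (t : ℕ)
    {f h : (Fin d → ℝ) → ℝ} (hf : Measurable f) (hh : Measurable h) {B B' : ℝ}
    (hB : ∀ a ∈ A, |f a| ≤ B) (hB' : ∀ a ∈ A, |h a| ≤ B') (hfh : ∀ a ∈ A, f a ≤ h a) :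
    alg.actionMean s ν t f ≤ alg.actionMean s ν t h :=
  integral_mono (alg.integrable_comp_action s ν t hf hB) (alg.integrable_comp_action s ν t hh hB')
    fun _ => hfh _ (alg.act_mem _ _ _)

lemma actionMean_const_mul (s : alg.Seed) (ν : Measure (Fin d → ℝ)) [IsProbabilityMeasure ν]
    (t : ℕ) (f : (Fin d → ℝ) → ℝ) (c : ℝ) :
    alg.actionMean s ν t (fun a => c * f a) = c * alg.actionMean s ν t f :=
  integral_const_mul c _

lemma actionMean_add (s : alg.Seed) (ν : Measure (Fin d → ℝ)) [IsProbabilityMeasure ν] (t : ℕ)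
    {f h : (Fin d → ℝ) → ℝ} (hf : Measurable f) (hh : Measurable h) {B B' : ℝ}
    (hB : ∀ a ∈ A, |f a| ≤ B) (hB' : ∀ a ∈ A, |h a| ≤ B') :
    alg.actionMean s ν t (fun a => f a + h a) = alg.actionMean s ν t f + alg.actionMean s ν t h :=
  integral_add (alg.integrable_comp_action s ν t hf hB) (alg.integrable_comp_action s ν t hh hB')

lemma actionMean_sum {ι : Type*} (I : Finset ι) (s : alg.Seed) (ν : Measure (Fin d → ℝ))
    [IsProbabilityMeasure ν] (t : ℕ) {f : ι → (Fin d → ℝ) → ℝ} (hf : ∀ i, Measurable (f i))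
    {B : ι → ℝ} (hB : ∀ i, ∀ a ∈ A, |f i a| ≤ B i) :
    alg.actionMean s ν t (fun a => ∑ i ∈ I, f i a) = ∑ i ∈ I, alg.actionMean s ν t (f i) :=
  integral_finsetSum I fun i _ => alg.integrable_comp_action s ν t (hf i) (hB i)

lemma actionMean_const (s : alg.Seed) (ν : Measure (Fin d → ℝ)) [IsProbabilityMeasure ν] (t : ℕ)
    (c : ℝ) : alg.actionMean s ν t (fun _ => c) = c := by
  simp [actionMean]

lemma actionMean_affine (s : alg.Seed) (ν : Measure (Fin d → ℝ)) [IsProbabilityMeasure ν] (t : ℕ)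
    {f : (Fin d → ℝ) → ℝ} (hf : Measurable f) {B : ℝ} (hB : ∀ a ∈ A, |f a| ≤ B) (x y : ℝ) :
    alg.actionMean s ν t (fun a => x + y * f a) = x + y * alg.actionMean s ν t f := by
  have hy : ∀ a ∈ A, |y * f a| ≤ |y| * B := fun a ha => by
    rw [abs_mul]
    exact mul_le_mul_of_nonneg_left (hB a ha) (abs_nonneg _)
  rw [alg.actionMean_add s ν t measurable_const (hf.const_mul y) (B := |x|) (B' := |y| * B)
    (fun _ _ => le_rfl) hy, actionMean_const, actionMean_const_mul]

lemma integral_regret (ν : Measure (Fin d → ℝ)) [IsProbabilityMeasure ν] (aStar : Fin d → ℝ)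
    {B : ℝ} (hB : ∀ a ∈ A, |a ⬝ᵥ meanVector ν| ≤ B) (T : ℕ) :
    Integrable (fun s => ∑ t ∈ Finset.range T, (aStar ⬝ᵥ meanVector ν
        - alg.actionMean s ν t fun a => a ⬝ᵥ meanVector ν)) alg.seedLaw ∧
    ∫ ω, alg.regret ν aStar T ω ∂(alg.law ν) = ∫ s, ∑ t ∈ Finset.range T,
      (aStar ⬝ᵥ meanVector ν - alg.actionMean s ν t fun a => a ⬝ᵥ meanVector ν) ∂alg.seedLaw := by
  have hdot : Measurable fun a : Fin d → ℝ => a ⬝ᵥ meanVector ν :=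
    measurable_dotProduct measurable_id measurable_const
  have hi : Integrable (fun ω => alg.regret ν aStar T ω) (alg.law ν) := by
    refine integrable_finsetSum _ fun t _ => ?_
    simp only [sub_dotProduct]
    have : IsProbabilityMeasure (alg.law ν) := by unfold law; infer_instance
    refine (integrable_const _).sub (Integrable.of_bound
      (hdot.comp (alg.measurable_action t)).aestronglyMeasurable B
      (Filter.Eventually.of_forall fun _ => hB _ (alg.act_mem _ _ _)))
  have e : ∀ s, ∫ θ, alg.regret ν aStar T (s, θ) ∂(Measure.infinitePi fun _ : ℕ => ν)
      = ∑ t ∈ Finset.range T, (aStar ⬝ᵥ meanVector ν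
        - alg.actionMean s ν t fun a => a ⬝ᵥ meanVector ν) := by
    intro s
    simp only [regret, sub_dotProduct]
    have hj := fun t => alg.integrable_comp_action s ν t hdot hB
    have hk : ∀ t, Integrable (fun θ => aStar ⬝ᵥ meanVector ν - alg.action s θ t ⬝ᵥ meanVector ν)
        (Measure.infinitePi fun _ : ℕ => ν) := fun t => (integrable_const _).sub (hj t)
    rw [integral_finsetSum _ fun t _ => hk t]
    refine Finset.sum_congr rfl fun t _ => ?_
    rw [integral_sub (integrable_const _) (hj t), integral_const]
    simp [actionMean]
  constructor
  · simpa only [e] using hi.integral_prod_left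
  · rw [law, integral_prod _ hi]
    simp only [e]

/-- If, for every fixed seed, the average regret over a finite family of environments is large, then
one of the environments is hard. -/
lemma exists_hard_environment {p : ENNReal} (hp : 1 ≤ p) (alg : BanditAlgorithm d (lpBall d p))
    {ι : Type*} [Fintype ι] [Nonempty ι] (μ : ι → Fin d → ℝ) (D : Fin d → ℝ) (T : ℕ) {σ C v : ℝ}
    (hv : ∀ i, ∃ b ∈ lpBall d p, v ≤ b ⬝ᵥ μ i)
    (hreg : ∀ s, (Fintype.card ι : ℝ) * C ≤ ∑ i, ∑ t ∈ Finset.range T,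
      (v - alg.actionMean s (g.rewardLaw (μ i) D) t fun a => a ⬝ᵥ μ i))
    (hbd : ∀ i, ∀ a ∈ lpBall d p, ∑ j, |a j| * (|μ i j| + |D j|) ≤ max 1 σ)
    (hvar : IsGreatest ((fun a => g.variance * ∑ j, D j ^ 2 * a j ^ 2) '' lpBall d p) (σ ^ 2 / 2)) :
    ∃ (ν : Measure (Fin d → ℝ)) (_ : IsProbabilityMeasure ν),
      (∀ a ∈ lpBall d p, ∀ᵐ θ ∂ν, |a ⬝ᵥ θ| ≤ max 1 σ) ∧
      IsGreatest (actionVariance ν '' lpBall d p) (σ ^ 2 / 2) ∧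
      ∃ aStar ∈ lpBall d p,
        IsMaxOn (fun a => a ⬝ᵥ meanVector ν) (lpBall d p) aStar ∧
        C ≤ ∫ ω, alg.regret ν aStar T ω ∂(alg.law ν) := by
  have hmax : ∀ i, ∃ x ∈ lpBall d p, IsMaxOn (fun a => a ⬝ᵥ μ i) (lpBall d p) x := fun i =>
    (isCompact_lpBall d hp).exists_isMaxOn ⟨0, zero_mem_lpBall d hp⟩
      (by unfold dotProduct; fun_prop)
  choose x hx hxmax using hmax
  have hB : ∀ i, ∀ a ∈ lpBall d p, |a ⬝ᵥ μ i| ≤ ∑ j, |μ i j| := fun i a ha => by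
    refine (Finset.abs_sum_le_sum_abs _ _).trans (Finset.sum_le_sum fun j _ => ?_)
    rw [abs_mul]
    exact mul_le_of_le_one_left (abs_nonneg _) (abs_le_one_of_mem_lpBall hp ha j)
  have hr := fun i => alg.integral_regret (g.rewardLaw (μ i) D) (x i) (B := ∑ j, |μ i j|)
    (by simpa only [g.meanVector_rewardLaw] using hB i) T
  simp only [g.meanVector_rewardLaw] at hr
  obtain ⟨i, -, hi⟩ : ∃ i ∈ Finset.univ, C
      ≤ ∫ ω, alg.regret (g.rewardLaw (μ i) D) (x i) T ω ∂(alg.law (g.rewardLaw (μ i) D)) := by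
    -- Averaging over environments inside the integral over the seed makes the chosen environment
    -- independent of the seed.
    refine Finset.exists_le_of_sum_le Finset.univ_nonempty ?_
    rw [Finset.sum_congr rfl fun i _ => (hr i).2, ← integral_finsetSum _ fun i _ => (hr i).1,
      Finset.sum_const, Finset.card_univ, nsmul_eq_mul]
    have h1 : ∫ _s : alg.Seed, ((Fintype.card ι : ℝ) * C) ∂alg.seedLaw = Fintype.card ι * C := by
      simp
    rw [← h1]
    refine integral_mono (integrable_const _) (integrable_finsetSum _ fun i _ => (hr i).1)
      fun s => (hreg s).trans (Finset.sum_le_sum fun i _ => Finset.sum_le_sum fun t _ => ?_)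
    obtain ⟨b, hb, hvb⟩ := hv i
    exact sub_le_sub_right (hvb.trans (hxmax i hb)) _
  refine ⟨g.rewardLaw (μ i) D, inferInstance, fun a ha => ?_, ?_, x i, hx i, ?_, hi⟩
  · filter_upwards [g.ae_abs_rewardLaw_sub_le (μ i) D] with θ hθ
    refine ((Finset.abs_sum_le_sum_abs _ _).trans (Finset.sum_le_sum fun j _ => ?_)).trans
      (hbd i a ha)
    rw [abs_mul]
    refine mul_le_mul_of_nonneg_left ?_ (abs_nonneg _)
    have := abs_add_le (θ j - μ i j) (μ i j)
    rw [sub_add_cancel] at this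
    linarith [hθ j]
  · have : actionVariance (g.rewardLaw (μ i) D) = fun a => g.variance * ∑ j, D j ^ 2 * a j ^ 2 :=
      funext fun a => g.actionVariance_rewardLaw (μ i) D a
    rwa [this]
  · simpa only [g.meanVector_rewardLaw] using hxmax i

/-- Noise scales with given ratios can be normalised to have a given maximal variance. -/
lemma exists_noise_scale {p : ENNReal} (hp : 1 ≤ p) (w : Fin d → ℝ) (i₀ : Fin d) (hw : w i₀ = 1)
    (hw2 : ∀ a ∈ lpBall d p, ∑ j, w j ^ 2 * a j ^ 2 ≤ 2) {σ : ℝ} (hσ : 0 < σ) :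
    ∃ s, σ / 2 ≤ s ∧ s ≤ 9 / 10 * σ ∧
      IsGreatest ((fun a => g.variance * ∑ j, (s * w j) ^ 2 * a j ^ 2) '' lpBall d p)
        (σ ^ 2 / 2) := by
  obtain ⟨x, hx, hmax⟩ := (isCompact_lpBall d hp).exists_isMaxOn ⟨0, zero_mem_lpBall d hp⟩
    (f := fun a => ∑ j, w j ^ 2 * a j ^ 2) (by fun_prop)
  set V := ∑ j, w j ^ 2 * x j ^ 2 with hV
  have hV2 : V ≤ 2 := hw2 x hx
  have hV1 : 1 ≤ V := by
    have : Fact (1 ≤ p) := ⟨hp⟩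
    have hm : Pi.single i₀ 1 ∈ lpBall d p := by
      exact (PiLp.norm_single p (fun _ : Fin d => ℝ) i₀ 1).trans_le (by simp)
    have := hmax hm
    simp only [Set.mem_ofPred_eq] at this
    refine le_trans (le_of_eq ?_) this
    rw [Finset.sum_eq_single i₀] <;> simp +contextual [hw]
  have hκ := g.le_variance
  have hκ1 := g.variance_le_one
  set κ := g.variance
  -- Since `σ² = 2κV s²`, the range `[16/25, 2]` of `κV` gives `σ/2 ≤ s ≤ 9σ/10`.
  have hκV : 16 / 25 ≤ κ * V := by nlinarith
  have hκV2 : κ * V ≤ 2 := by nlinarith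
  have hpos : 0 < 2 * (κ * V) := by linarith
  set s := σ / Real.sqrt (2 * (κ * V)) with hs
  have hs0 : 0 < s := by positivity
  have hs2 : s ^ 2 * (2 * (κ * V)) = σ ^ 2 := by
    rw [hs, div_pow, Real.sq_sqrt hpos.le, div_mul_cancel₀ _ hpos.ne']
  have e : ∀ a : Fin d → ℝ, κ * ∑ j, (s * w j) ^ 2 * a j ^ 2
      = κ * s ^ 2 * ∑ j, w j ^ 2 * a j ^ 2 := by
    intro a
    rw [mul_assoc, Finset.mul_sum _ _ (s ^ 2)]
    congr 1
    exact Finset.sum_congr rfl fun j _ => by ring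
  refine ⟨s, ?_, ?_, ⟨x, hx, ?_⟩, ?_⟩
  · refine abs_le_of_sq_le_sq' ?_ hs0.le |>.2
    nlinarith [sq_nonneg s]
  · refine abs_le_of_sq_le_sq' ?_ (by positivity) |>.2
    nlinarith [sq_nonneg s]
  · dsimp only
    rw [e, ← hV]; linarith
  · rintro _ ⟨a, ha, rfl⟩
    dsimp only
    rw [e]
    have h1 : ∑ j, w j ^ 2 * a j ^ 2 ≤ V := hmax ha
    have h2 : 0 ≤ κ * s ^ 2 := by positivity
    nlinarith

end BanditAlgorithm

/-! ### Averaging over sign patterns. -/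

namespace BanditAlgorithm

variable (g : NoiseAmplitude)

/-- The mean vector with first entry `M` and further entries `±Δ`. -/
noncomputable def signMean {n : ℕ} (M Δ : ℝ) (ε : Fin n → ℤˣ) : Fin (n + 1) → ℝ :=
  Fin.cons M fun i => Δ * ((ε i : ℤ) : ℝ)

/-- The sign vector with the `i`-th sign flipped. -/
def flipSign {n : ℕ} (i : Fin n) : Equiv.Perm (Fin n → ℤˣ) := Equiv.mulRight (Pi.mulSingle i (-1))

lemma flipSign_apply_self {n : ℕ} (i : Fin n) (ε : Fin n → ℤˣ) : flipSign i ε i = -ε i := by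
  simp [flipSign]

lemma flipSign_apply_ne {n : ℕ} {i j : Fin n} (h : j ≠ i) (ε : Fin n → ℤˣ) :
    flipSign i ε j = ε j := by
  simp [flipSign, h]

lemma signMean_flipSign_sub {n : ℕ} (M Δ : ℝ) (i : Fin n) (ε : Fin n → ℤˣ) :
    signMean M Δ (flipSign i ε) - signMean M Δ ε
      = Pi.single i.succ (-(2 * Δ * ((ε i : ℤ) : ℝ))) := by
  ext j
  refine Fin.cases ?_ (fun j => ?_) j
  · simp [signMean]
  · rcases eq_or_ne j i with rfl | h
    · simp [signMean, flipSign_apply_self]; ring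
    · simp [signMean, flipSign_apply_ne h, h]

lemma sq_units_cast (u : ℤˣ) : ((u : ℤ) : ℝ) ^ 2 = 1 := by
  rcases Int.units_eq_one_or u with rfl | rfl <;> simp

lemma abs_units_cast (u : ℤˣ) : |((u : ℤ) : ℝ)| = 1 := by
  rcases Int.units_eq_one_or u with rfl | rfl <;> simp

lemma snr_single {d : ℕ} (k : Fin d) (c : ℝ) (D a : Fin d → ℝ) :
    snr (Pi.single k c) D a = c ^ 2 * (a k ^ 2 / ∑ j, D j ^ 2 * a j ^ 2) := by
  rw [snr, dotProduct_single]
  ring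

/-- On average over the signs, the actions are barely correlated with the signs. -/
lemma sum_sign_mul_actionMean_le {n : ℕ} {A : Set (Fin (n + 1) → ℝ)}
    (alg : BanditAlgorithm (n + 1) A) (hA : ∀ a ∈ A, ∀ j, |a j| ≤ 1) (s : alg.Seed) (M Δ : ℝ)
    (D : Fin (n + 1) → ℝ) (hD : ∀ j, D j ≠ 0) (t : ℕ) {l : ℝ} (hl : 0 < l) (i : Fin n) :
    ∑ ε : Fin n → ℤˣ, ((ε i : ℤ) : ℝ)
        * alg.actionMean s (g.rewardLaw (signMean M Δ ε) D) t (fun a => a i.succ)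
      ≤ ∑ ε : Fin n → ℤˣ,
        (l * alg.actionMean s (g.rewardLaw (signMean M Δ ε) D) t (fun a => a i.succ ^ 2)
          + g.hellingerConst / (2 * l) * ∑ r ∈ Finset.range t,
            alg.actionMean s (g.rewardLaw (signMean M Δ ε) D) r
              (snr (Pi.single i.succ (2 * Δ)) D)) := by
  set K : (Fin n → ℤˣ) → ℝ := fun ε => ((ε i : ℤ) : ℝ)
        * alg.actionMean s (g.rewardLaw (signMean M Δ ε) D) t (fun a => a i.succ) with hK
  set H : (Fin n → ℤˣ) → ℝ := fun ε =>
        l * alg.actionMean s (g.rewardLaw (signMean M Δ ε) D) t (fun a => a i.succ ^ 2)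
          + g.hellingerConst / (2 * l) * ∑ r ∈ Finset.range t,
            alg.actionMean s (g.rewardLaw (signMean M Δ ε) D) r
              (snr (Pi.single i.succ (2 * Δ)) D) with hH
  have key : ∀ ε, K ε + K (flipSign i ε) ≤ H ε + H (flipSign i ε) := by
    intro ε
    have h := alg.actionMean_sub_le g s (signMean M Δ ε) (signMean M Δ (flipSign i ε)) D hD t
      (f := fun a => ((ε i : ℤ) : ℝ) * a i.succ) (by fun_prop) (B := 1)
      (fun a ha => by rw [abs_mul, abs_units_cast, one_mul]; exact hA a ha _) hl
    -- Flipping changes the mean only in one entry, and `snr` sees only the square of that change,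
    -- so the sign pattern drops out.
    have e : snr (signMean M Δ (flipSign i ε) - signMean M Δ ε) D
        = snr (Pi.single i.succ (2 * Δ)) D := by
      ext a
      rw [signMean_flipSign_sub, snr_single, snr_single, neg_sq, mul_pow _ ((ε i : ℤ) : ℝ),
        sq_units_cast, mul_one]
    simp only [e, actionMean_const_mul, mul_pow, sq_units_cast, one_mul,
      Finset.sum_add_distrib] at h
    simp only [hK, hH, flipSign_apply_self, Units.val_neg, Int.cast_neg]
    linarith
  have h1 := Finset.sum_le_sum fun ε (_ : ε ∈ Finset.univ) => key ε
  -- Flipping permutes the sign patterns, so both sides of the summed inequality are doubled.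
  rw [Finset.sum_add_distrib, Finset.sum_add_distrib, Equiv.sum_comp (flipSign i) K,
    Equiv.sum_comp (flipSign i) H] at h1
  linarith

lemma sum_range_sum_range_le (T : ℕ) {x : ℕ → ℝ} (hx : ∀ r, 0 ≤ x r) :
    ∑ t ∈ Finset.range T, ∑ r ∈ Finset.range t, x r ≤ T * ∑ r ∈ Finset.range T, x r := by
  have : ∀ t ∈ Finset.range T, ∑ r ∈ Finset.range t, x r ≤ ∑ r ∈ Finset.range T, x r := by
    intro t ht
    exact Finset.sum_le_sum_of_subset_of_nonneg
      (Finset.range_subset_range.2 (Finset.mem_range.1 ht).le) fun _ _ _ => hx _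
  simpa using Finset.sum_le_sum this

/-- The regret, averaged over the signs, of an algorithm with a fixed seed. The hypotheses bound the
gain and the information of an action by affine functions of its exploration cost `1 - a 0`. -/
lemma card_mul_le_sum_regret {n : ℕ} {A : Set (Fin (n + 1) → ℝ)}
    (alg : BanditAlgorithm (n + 1) A) (hA : ∀ a ∈ A, ∀ j, |a j| ≤ 1) (s : alg.Seed) {M Δ : ℝ}
    (hΔ : 0 ≤ Δ) (D : Fin (n + 1) → ℝ) (hD : ∀ j, D j ≠ 0) (T : ℕ) {l : ℝ} (hl : 0 < l)
    {Ay By Ag Bg γ : ℝ}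
    (hy : ∀ a ∈ A, ∑ i : Fin n, a i.succ ^ 2 ≤ Ay + By * (1 - a 0))
    (hg : ∀ a ∈ A, ∑ i : Fin n, snr (Pi.single i.succ (2 * Δ)) D a ≤ Ag + Bg * (1 - a 0))
    (h1 : Δ * (l * Ay + g.hellingerConst * T / (2 * l) * Ag) ≤ γ)
    (h2 : Δ * (l * By + g.hellingerConst * T / (2 * l) * Bg) ≤ M) :
    (Fintype.card (Fin n → ℤˣ) : ℝ) * (T * γ) ≤ ∑ ε : Fin n → ℤˣ, ∑ t ∈ Finset.range T,
      (M + 2 * γ - alg.actionMean s (g.rewardLaw (signMean M Δ ε) D) t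
        fun a => a ⬝ᵥ signMean M Δ ε) := by
  set L := g.hellingerConst
  have hL : 0 ≤ L := g.hellingerConst_nonneg
  set E : (Fin n → ℤˣ) → ℕ → ((Fin (n + 1) → ℝ) → ℝ) → ℝ := fun ε t f =>
    alg.actionMean s (g.rewardLaw (signMean M Δ ε) D) t f with hE
  have hcoord : ∀ j, Measurable fun a : Fin (n + 1) → ℝ => a j := measurable_pi_apply
  have hw0 : ∀ a ∈ A, |1 - a 0| ≤ 2 := fun a ha => by
    have := abs_le.1 (hA a ha 0)
    rw [abs_le]; constructor <;> linarith [this.1, this.2]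
  have hwm : Measurable fun a : Fin (n + 1) → ℝ => 1 - a 0 := (hcoord 0).const_sub 1
  have habd : ∀ x y : ℝ, ∀ a ∈ A, |x + y * (1 - a 0)| ≤ |x| + |y| * 2 := fun x y a ha => by
    refine (abs_add_le _ _).trans (add_le_add le_rfl ?_)
    rw [abs_mul]
    exact mul_le_mul_of_nonneg_left (hw0 a ha) (abs_nonneg _)
  have haffm : ∀ x y : ℝ, Measurable fun a : Fin (n + 1) → ℝ => x + y * (1 - a 0) := fun x y =>
    (hwm.const_mul y).const_add x
  have hsqb : ∀ i : Fin n, ∀ a ∈ A, |a i.succ ^ 2| ≤ 1 := fun i a ha => by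
    rw [abs_pow]; exact pow_le_one₀ (abs_nonneg _) (hA a ha _)
  have hsnrb : ∀ i : Fin n, ∀ a ∈ A, |snr (Pi.single i.succ (2 * Δ)) D a|
      ≤ ∑ j, ((Pi.single i.succ (2 * Δ) : Fin (n + 1) → ℝ) j / D j) ^ 2 := fun i a _ => by
    rw [abs_of_nonneg (snr_nonneg _ _ _)]
    exact snr_le _ _ _ hD
  have hsnrm := fun i : Fin n => measurable_snr (Pi.single i.succ (2 * Δ)) D
  have hdot : ∀ ε t, E ε t (fun a => a ⬝ᵥ signMean M Δ ε)
      = M - M * E ε t (fun a => 1 - a 0)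
        + Δ * ∑ i : Fin n, ((ε i : ℤ) : ℝ) * E ε t (fun a => a i.succ) := by
    intro ε t
    have e : (fun a : Fin (n + 1) → ℝ => a ⬝ᵥ signMean M Δ ε) = fun a =>
        (M + (-M) * (1 - a 0)) + ∑ i : Fin n, (Δ * ((ε i : ℤ) : ℝ)) * a i.succ := by
      ext a
      rw [dotProduct, Fin.sum_univ_succ]
      simp only [signMean, Fin.cons_zero, Fin.cons_succ]
      congr 1
      · ring
      · exact Finset.sum_congr rfl fun i _ => by ring
    have hb : ∀ i : Fin n, ∀ a ∈ A, |(Δ * ((ε i : ℤ) : ℝ)) * a i.succ| ≤ |Δ| := fun i a ha => by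
      rw [abs_mul, abs_mul, abs_units_cast, mul_one]
      exact mul_le_of_le_one_right (abs_nonneg _) (hA a ha _)
    have hsum : ∀ a ∈ A, |∑ i : Fin n, (Δ * ((ε i : ℤ) : ℝ)) * a i.succ| ≤ ∑ _i : Fin n, |Δ| :=
      fun a ha => (Finset.abs_sum_le_sum_abs _ _).trans (Finset.sum_le_sum fun i _ => hb i a ha)
    rw [hE]
    dsimp only
    rw [e, alg.actionMean_add s _ t (haffm _ _) (by fun_prop) (habd _ _) hsum,
      alg.actionMean_affine s _ t hwm hw0, alg.actionMean_sum _ s _ t (by fun_prop) hb]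
    simp only [actionMean_const_mul, Finset.mul_sum]
    congr 1
    · ring
    · exact Finset.sum_congr rfl fun i _ => by ring
  have hEy : ∀ ε t, ∑ i : Fin n, E ε t (fun a => a i.succ ^ 2)
      ≤ Ay + By * E ε t (fun a => 1 - a 0) := by
    intro ε t
    rw [hE]
    dsimp only
    rw [← alg.actionMean_sum _ s _ t (f := fun (i : Fin n) a => a i.succ ^ 2)
      (fun i => (hcoord i.succ).pow_const 2) hsqb,
      ← alg.actionMean_affine s _ t hwm hw0]
    exact alg.actionMean_mono s _ t (by fun_prop) (haffm _ _)
      (fun a ha => (Finset.abs_sum_le_sum_abs _ _).trans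
        (Finset.sum_le_sum fun i _ => hsqb i a ha)) (habd _ _) hy
  have hEg : ∀ ε t, ∑ i : Fin n, E ε t (snr (Pi.single i.succ (2 * Δ)) D)
      ≤ Ag + Bg * E ε t (fun a => 1 - a 0) := by
    intro ε t
    rw [hE]
    dsimp only
    rw [← alg.actionMean_sum _ s _ t hsnrm hsnrb, ← alg.actionMean_affine s _ t hwm hw0]
    exact alg.actionMean_mono s _ t (Finset.measurable_sum _ fun i _ => hsnrm i) (haffm _ _)
      (fun a ha => (Finset.abs_sum_le_sum_abs _ _).trans
        (Finset.sum_le_sum fun i _ => hsnrb i a ha)) (habd _ _) hg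
  have hEw : ∀ ε t, 0 ≤ E ε t (fun a => 1 - a 0) := fun ε t =>
    integral_nonneg fun θ => sub_nonneg.2 (abs_le.1 (hA _ (alg.act_mem _ _ _) 0)).2
  have hEs : ∀ ε t (i : Fin n), 0 ≤ E ε t (snr (Pi.single i.succ (2 * Δ)) D) := fun ε t i =>
    alg.actionMean_nonneg s _ t (snr_nonneg _ _)
  have hcorr : ∑ ε : Fin n → ℤˣ, ∑ t ∈ Finset.range T, ∑ i : Fin n,
        ((ε i : ℤ) : ℝ) * E ε t (fun a => a i.succ)
      ≤ ∑ ε : Fin n → ℤˣ, ∑ t ∈ Finset.range T,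
        (l * (Ay + By * E ε t (fun a => 1 - a 0))
          + L * T / (2 * l) * (Ag + Bg * E ε t (fun a => 1 - a 0))) := by
    calc _ = ∑ t ∈ Finset.range T, ∑ i : Fin n, ∑ ε : Fin n → ℤˣ,
        ((ε i : ℤ) : ℝ) * E ε t (fun a => a i.succ) := by
          rw [Finset.sum_comm]
          exact Finset.sum_congr rfl fun t _ => Finset.sum_comm
      _ ≤ ∑ t ∈ Finset.range T, ∑ i : Fin n, ∑ ε : Fin n → ℤˣ,
          (l * E ε t (fun a => a i.succ ^ 2) + L / (2 * l) * ∑ r ∈ Finset.range t,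
            E ε r (snr (Pi.single i.succ (2 * Δ)) D)) :=
          Finset.sum_le_sum fun t _ => Finset.sum_le_sum fun i _ =>
            sum_sign_mul_actionMean_le g alg hA s M Δ D hD t hl i
      _ = ∑ ε : Fin n → ℤˣ, (l * ∑ t ∈ Finset.range T, ∑ i : Fin n, E ε t (fun a => a i.succ ^ 2)
          + L / (2 * l) * ∑ t ∈ Finset.range T, ∑ r ∈ Finset.range t,
            ∑ i : Fin n, E ε r (snr (Pi.single i.succ (2 * Δ)) D)) := by
          have c1 : ∀ t, ∑ i : Fin n, ∑ ε : Fin n → ℤˣ,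
              (l * E ε t (fun a => a i.succ ^ 2) + L / (2 * l) * ∑ r ∈ Finset.range t,
              E ε r (snr (Pi.single i.succ (2 * Δ)) D))
              = ∑ ε : Fin n → ℤˣ, (l * ∑ i : Fin n, E ε t (fun a => a i.succ ^ 2)
              + L / (2 * l) * ∑ r ∈ Finset.range t,
              ∑ i : Fin n, E ε r (snr (Pi.single i.succ (2 * Δ)) D)) := by
            intro t
            rw [Finset.sum_comm]
            refine Finset.sum_congr rfl fun ε _ => ?_
            rw [Finset.sum_add_distrib, ← Finset.mul_sum, ← Finset.mul_sum, Finset.sum_comm]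
          rw [Finset.sum_congr rfl fun t _ => c1 t, Finset.sum_comm]
          refine Finset.sum_congr rfl fun ε _ => ?_
          rw [Finset.sum_add_distrib, ← Finset.mul_sum, ← Finset.mul_sum]
      _ ≤ _ := by
          refine Finset.sum_le_sum fun ε _ => ?_
          rw [Finset.sum_add_distrib, ← Finset.mul_sum, ← Finset.mul_sum]
          have q1 : ∑ t ∈ Finset.range T, ∑ i : Fin n, E ε t (fun a => a i.succ ^ 2)
              ≤ ∑ t ∈ Finset.range T, (Ay + By * E ε t (fun a => 1 - a 0)) :=
            Finset.sum_le_sum fun t _ => hEy ε t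
          -- Information gathered in round `r` is charged to all `T` rounds; this is the factor `T`
          -- in `h1` and `h2`.
          have q2 : ∑ t ∈ Finset.range T, ∑ r ∈ Finset.range t,
              ∑ i : Fin n, E ε r (snr (Pi.single i.succ (2 * Δ)) D)
              ≤ T * ∑ t ∈ Finset.range T, (Ag + Bg * E ε t (fun a => 1 - a 0)) :=
            (sum_range_sum_range_le T fun r => Finset.sum_nonneg fun i _ => hEs ε r i).trans
              (mul_le_mul_of_nonneg_left (Finset.sum_le_sum fun t _ => hEg ε t) T.cast_nonneg)
          have q3 := mul_le_mul_of_nonneg_left q1 hl.le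
          have q4 := mul_le_mul_of_nonneg_left q2 (show 0 ≤ L / (2 * l) by positivity)
          calc _ ≤ _ := add_le_add q3 q4
            _ = _ := by ring
  have hcorr2 := mul_le_mul_of_nonneg_left hcorr hΔ
  simp only [Finset.mul_sum Finset.univ _ Δ, Finset.mul_sum (Finset.range T) _ Δ] at hcorr2
  -- By `h2` the terms proportional to `1 - a 0` are paid for by the loss `M (1 - a 0)`, and by `h1`
  -- the constant terms use up at most one of the two `γ`.
  have hterm : ∀ ε t, γ ≤ M + 2 * γ - (M - M * E ε t (fun a => 1 - a 0)
      + Δ * (l * (Ay + By * E ε t (fun a => 1 - a 0))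
          + L * T / (2 * l) * (Ag + Bg * E ε t (fun a => 1 - a 0)))) := by
    intro ε t
    have := mul_le_mul_of_nonneg_right h2 (hEw ε t)
    nlinarith
  have hfin : ∑ _ε : Fin n → ℤˣ, ∑ _t ∈ Finset.range T, γ ≤ _ :=
    Finset.sum_le_sum fun ε _ => Finset.sum_le_sum fun t _ => hterm ε t
  change _ ≤ ∑ ε : Fin n → ℤˣ, ∑ t ∈ Finset.range T,
      (M + 2 * γ - E ε t fun a => a ⬝ᵥ signMean M Δ ε)
  simp only [hdot]
  simp only [Finset.sum_sub_distrib, Finset.sum_add_distrib] at hfin ⊢ hcorr2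
  simp only [mul_add, Finset.sum_add_distrib, Finset.sum_const, Finset.card_univ,
    Finset.card_range, nsmul_eq_mul, Finset.mul_sum] at hfin ⊢ hcorr2
  linarith

end BanditAlgorithm

/-! ### The two-point test in dimension one, and the information of a single action. -/

namespace BanditAlgorithm

variable (g : NoiseAmplitude)

/-- The regret lower bound in dimension one for a fixed seed. -/
lemma one_dim_regret {A : Set (Fin 1 → ℝ)} (alg : BanditAlgorithm 1 A)
    (hA : ∀ a ∈ A, ∀ j, |a j| ≤ 1) (s : alg.Seed) {Δ D : ℝ} (hΔ : 0 ≤ Δ) (hD : D ≠ 0) (T : ℕ)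
    (h : 16 * g.hellingerConst * T * (Δ / D) ^ 2 ≤ 1 / 2) :
    (Fintype.card ℤˣ : ℝ) * (T * (Δ / 2)) ≤ ∑ e : ℤˣ, ∑ t ∈ Finset.range T,
      (Δ - alg.actionMean s (g.rewardLaw (fun _ => Δ * ((e : ℤ) : ℝ)) fun _ => D) t
        fun a => a ⬝ᵥ fun _ => Δ * ((e : ℤ) : ℝ)) := by
  have hL := g.hellingerConst_nonneg
  set μ : Fin 1 → ℝ := fun _ => Δ with hμ
  set μ' : Fin 1 → ℝ := fun _ => -Δ with hμ'
  set E : (Fin 1 → ℝ) → ℕ → ((Fin 1 → ℝ) → ℝ) → ℝ := fun m t f =>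
    alg.actionMean s (g.rewardLaw m fun _ => D) t f with hE
  have hsq : ∀ m t, E m t (fun a => a 0 ^ 2) ≤ 1 := fun m t => by
    have := alg.actionMean_mono s (g.rewardLaw m fun _ => D) t (f := fun a => a 0 ^ 2)
      (h := fun _ => 1) (by fun_prop) measurable_const (B := 1) (B' := 1)
      (fun a ha => by rw [abs_pow]; exact pow_le_one₀ (abs_nonneg _) (hA a ha 0)) (by simp)
      (fun a ha => (sq_le_one_iff_abs_le_one _).2 (hA a ha 0))
    rwa [actionMean_const] at this
  have hsnr : ∀ m t, E m t (snr (μ' - μ) fun _ => D) ≤ 4 * (Δ / D) ^ 2 := fun m t => by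
    have hle : ∀ a, snr (μ' - μ) (fun _ => D) a ≤ 4 * (Δ / D) ^ 2 := fun a => by
      refine (snr_le (μ' - μ) (fun _ => D) a fun _ => hD).trans (le_of_eq ?_)
      simp only [hμ, hμ', Pi.sub_apply, Finset.univ_unique, Finset.sum_const, Finset.card_singleton,
        one_smul]
      ring
    have := alg.actionMean_mono s (g.rewardLaw m fun _ => D) t (measurable_snr (μ' - μ) fun _ => D)
      (measurable_const (a := 4 * (Δ / D) ^ 2)) (B := 4 * (Δ / D) ^ 2) (B' := 4 * (Δ / D) ^ 2)
      (fun a _ => by rw [abs_of_nonneg (snr_nonneg _ _ _)]; exact hle a)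
      (fun a _ => by rw [abs_of_nonneg (by positivity)]) (fun a _ => hle a)
    rwa [actionMean_const] at this
  have hdot : ∀ m t (c : ℝ), E m t (fun a => a ⬝ᵥ fun _ => c) = c * E m t (fun a => a 0) := by
    intro m t c
    rw [hE]
    dsimp only
    rw [← actionMean_const_mul]
    congr 1
    ext a
    simp [dotProduct, mul_comm]
  have hdiff : ∀ t ∈ Finset.range T, E μ t (fun a => a 0) - E μ' t (fun a => a 0) ≤ 1 := by
    intro t ht
    -- With `l = 1/4` the second moments contribute at most `1/2`, and hypothesis `h` bounds the
    -- information term by another `1/2`.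
    have h1 := alg.actionMean_sub_le g s μ μ' (fun _ => D) (fun _ => hD) t (f := fun a => a 0)
      (by fun_prop) (B := 1) (fun a ha => hA a ha 0) (l := 1 / 4) (by norm_num)
    have h2 : ∑ r ∈ Finset.range t, (E μ r (snr (μ' - μ) fun _ => D)
        + E μ' r (snr (μ' - μ) fun _ => D)) ≤ T * (8 * (Δ / D) ^ 2) := by
      have h3 : ∀ r ∈ Finset.range t, E μ r (snr (μ' - μ) fun _ => D)
        + E μ' r (snr (μ' - μ) fun _ => D) ≤ 8 * (Δ / D) ^ 2 := fun r _ => by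
          linarith [hsnr μ r, hsnr μ' r]
      refine (Finset.sum_le_sum h3).trans ?_
      rw [Finset.sum_const, Finset.card_range, nsmul_eq_mul]
      have : (t : ℝ) ≤ T := by exact_mod_cast (Finset.mem_range.1 ht).le
      gcongr
    have h4 := mul_le_mul_of_nonneg_left h2 hL
    have h5 := hsq μ t
    have h6 := hsq μ' t
    simp only [hE] at h4 h5 h6 ⊢
    norm_num at h1
    linarith
  have hsum : ∀ F : ℤˣ → ℝ, ∑ e : ℤˣ, F e = F 1 + F (-1) := fun F => by
    rw [show (Finset.univ : Finset ℤˣ) = {1, -1} from rfl, Finset.sum_pair (by decide)]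
  rw [hsum, ← Finset.sum_add_distrib]
  have hcard : (Fintype.card ℤˣ : ℝ) = 2 := by norm_num
  have hterm : ∀ t ∈ Finset.range T, Δ ≤ (Δ - E μ t fun a => a ⬝ᵥ fun _ => Δ)
      + (Δ - E μ' t fun a => a ⬝ᵥ fun _ => -Δ) := fun t ht => by
    rw [hdot, hdot]
    nlinarith [mul_le_mul_of_nonneg_left (hdiff t ht) hΔ]
  have := Finset.sum_le_sum hterm
  rw [Finset.sum_const, Finset.card_range, nsmul_eq_mul] at this
  rw [hcard]
  simp only [Units.val_one, Int.cast_one, mul_one, Units.val_neg, Int.cast_neg, mul_neg]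
  simp only [hE] at this
  linarith

/-- The total information of an action about the signs. -/
lemma sum_snr_le {n : ℕ} {a : Fin (n + 1) → ℝ} {s ρ σ Δ : ℝ} (hσ : 0 < σ) (hs : σ / 2 ≤ s)
    (hρ : 0 < ρ) (ha : a 0 ≤ 1) :
    ∑ i : Fin n, snr (Pi.single i.succ (2 * Δ)) (fun j => s * (Fin.cons 1 fun _ => ρ : _ → ℝ) j) a
      ≤ 64 * Δ ^ 2 / σ ^ 2 * ∑ i : Fin n, a i.succ ^ 2
        + 32 * Δ ^ 2 / (ρ ^ 2 * σ ^ 2) * (1 - a 0) := by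
  set y := ∑ i : Fin n, a i.succ ^ 2 with hy
  have hy0 : 0 ≤ y := Finset.sum_nonneg fun _ _ => sq_nonneg _
  have hs0 : 0 < s := by linarith
  have hs2 : σ ^ 2 / 4 ≤ s ^ 2 := by nlinarith
  have hW : ∑ j, (s * (Fin.cons 1 fun _ => ρ : Fin (n + 1) → ℝ) j) ^ 2 * a j ^ 2
      = s ^ 2 * a 0 ^ 2 + ρ ^ 2 * s ^ 2 * y := by
    rw [Fin.sum_univ_succ, hy, Finset.mul_sum]
    simp only [Fin.cons_zero, Fin.cons_succ]
    congr 1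
    · ring
    · exact Finset.sum_congr rfl fun i _ => by ring
  simp only [snr_single, hW]
  rw [← Finset.mul_sum, ← Finset.sum_div, ← hy]
  set W := s ^ 2 * a 0 ^ 2 + ρ ^ 2 * s ^ 2 * y
  have key : y / W ≤ 16 / σ ^ 2 * y + 8 / (ρ ^ 2 * σ ^ 2) * (1 - a 0) := by
    have hn1 : 0 ≤ 16 / σ ^ 2 * y := by positivity
    have hn2 : 0 ≤ 8 / (ρ ^ 2 * σ ^ 2) * (1 - a 0) := mul_nonneg (by positivity) (by linarith)
    -- For `a 0 ≥ 1/2` the first coordinate alone gives `W ≥ σ²/16`. Otherwise only the small noise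
    -- is left, but `1 - a 0 > 1/2` pays for the larger bound.
    by_cases h : 1 / 2 ≤ a 0
    · have h1 : σ ^ 2 / 16 ≤ W := by
        have : 1 / 4 ≤ a 0 ^ 2 := by nlinarith
        have h2 : 0 ≤ ρ ^ 2 * s ^ 2 * y := by positivity
        nlinarith
      have h2 : y / W ≤ y / (σ ^ 2 / 16) := by gcongr
      have h3 : y / (σ ^ 2 / 16) = 16 / σ ^ 2 * y := by field_simp
      linarith
    · have h1 : ρ ^ 2 * (σ ^ 2 / 4) * y ≤ W := by
        have : ρ ^ 2 * (σ ^ 2 / 4) * y ≤ ρ ^ 2 * s ^ 2 * y := by gcongr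
        have h2 : 0 ≤ s ^ 2 * a 0 ^ 2 := by positivity
        linarith
      have h2 : y / W ≤ 4 / (ρ ^ 2 * σ ^ 2) := by
        refine div_le_of_le_mul₀ (by positivity) (by positivity) ?_
        calc y = 4 / (ρ ^ 2 * σ ^ 2) * (ρ ^ 2 * (σ ^ 2 / 4) * y) := by field_simp
          _ ≤ _ := by gcongr
      have h3 : 8 / (ρ ^ 2 * σ ^ 2) * (1 / 2) ≤ 8 / (ρ ^ 2 * σ ^ 2) * (1 - a 0) := by
        gcongr; linarith
      have h4 : 8 / (ρ ^ 2 * σ ^ 2) * (1 / 2) = 4 / (ρ ^ 2 * σ ^ 2) := by ring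
      linarith
  calc (2 * Δ) ^ 2 * (y / W) ≤ (2 * Δ) ^ 2 * (16 / σ ^ 2 * y + 8 / (ρ ^ 2 * σ ^ 2) * (1 - a 0)) := by
        gcongr
    _ = _ := by ring

end BanditAlgorithm

/-! ### Choice of the parameters and the hard instances. -/

namespace BanditAlgorithm

variable (g : NoiseAmplitude)

/-- The scale of the gaps in the hard instances. -/
noncomputable def gapConst : ℝ := 1 / (2 * (1 + 1000 * g.hellingerConst))

lemma gapConst_pos : 0 < gapConst g := by
  have := g.hellingerConst_nonneg
  unfold gapConst
  positivity

lemma gapConst_mul : gapConst g * (1 + 1000 * g.hellingerConst) = 1 / 2 := by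
  have := g.hellingerConst_nonneg
  unfold gapConst
  field_simp

/-- The lower bound in dimension one. -/
lemma exists_hard_one_dim {p : ENNReal} (hp : 1 ≤ p) {T : ℕ} (hT : 1 ≤ T) {σ : ℝ} (hσ : 0 < σ)
    (alg : BanditAlgorithm 1 (lpBall 1 p)) :
    ∃ (ν : Measure (Fin 1 → ℝ)) (_ : IsProbabilityMeasure ν),
      (∀ a ∈ lpBall 1 p, ∀ᵐ θ ∂ν, |a ⬝ᵥ θ| ≤ max 1 σ) ∧
      IsGreatest (actionVariance ν '' lpBall 1 p) (σ ^ 2 / 2) ∧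
      ∃ aStar ∈ lpBall 1 p,
        IsMaxOn (fun a => a ⬝ᵥ meanVector ν) (lpBall 1 p) aStar ∧
        gapConst g / 1600 * (Real.sqrt T * σ) ≤ ∫ ω, alg.regret ν aStar T ω ∂(alg.law ν) := by
  have hL := g.hellingerConst_nonneg
  have hc0 := gapConst_pos g
  have hc := gapConst_mul g
  set c := gapConst g
  have hcL : 0 ≤ c * g.hellingerConst := by positivity
  have hc1 : c ≤ 1 / 2 := by nlinarith
  have hT1 : (1 : ℝ) ≤ T := by exact_mod_cast hT
  have hq1 : 1 ≤ Real.sqrt T := Real.one_le_sqrt.2 hT1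
  have hq2 : Real.sqrt T ^ 2 = T := Real.sq_sqrt (by linarith)
  set q := Real.sqrt T
  have hA : ∀ a ∈ lpBall 1 p, ∀ j, |a j| ≤ 1 := fun a ha => abs_le_one_of_mem_lpBall hp ha
  obtain ⟨s, hs1, hs2, hvar⟩ := exists_noise_scale g hp (fun _ : Fin 1 => (1 : ℝ)) 0 rfl
    (fun a ha => by
      have := (sq_le_one_iff_abs_le_one _).2 (hA a ha 0)
      simp only [Finset.univ_unique, Fin.default_eq_zero, Finset.sum_singleton]
      linarith) hσ
  have hs0 : 0 < s := by linarith
  set Δ := c / 10 * s / q with hΔ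
  have hΔ0 : 0 ≤ Δ := by positivity
  have hΔs : Δ ≤ 1 / 20 * s := by
    rw [hΔ, div_le_iff₀ (by positivity)]
    nlinarith [mul_le_mul_of_nonneg_right hc1 hs0.le]
  simp only [mul_one] at hvar
  have hv : ∀ e : ℤˣ, ∃ b ∈ lpBall 1 p, Δ ≤ b ⬝ᵥ fun _ => Δ * ((e : ℤ) : ℝ) := fun e => by
    have : Fact (1 ≤ p) := ⟨hp⟩
    refine ⟨Pi.single 0 ((e : ℤ) : ℝ), (PiLp.norm_single p (fun _ : Fin 1 => ℝ) 0 _).trans_le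
      (by rw [Real.norm_eq_abs, abs_units_cast]), ?_⟩
    rw [single_dotProduct]
    have := sq_units_cast e
    nlinarith
  have hinfo : 16 * g.hellingerConst * T * (Δ / s) ^ 2 ≤ 1 / 2 := by
    have e : (T : ℝ) * (Δ / s) ^ 2 = c ^ 2 / 100 := by
      rw [hΔ, ← hq2]; field_simp; norm_num
    calc 16 * g.hellingerConst * T * (Δ / s) ^ 2 = 16 * g.hellingerConst * (T * (Δ / s) ^ 2) := by
          ring
      _ = 16 / 100 * (c * g.hellingerConst) * c := by rw [e]; ring
      _ ≤ 1 / 2 := by nlinarith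
  have hbd : ∀ e : ℤˣ, ∀ a ∈ lpBall 1 p,
      ∑ j, |a j| * (|Δ * ((e : ℤ) : ℝ)| + |s|) ≤ max 1 σ := fun e a ha => by
    simp only [Finset.univ_unique, Fin.default_eq_zero, Finset.sum_singleton, abs_mul,
      abs_units_cast, mul_one, abs_of_nonneg hΔ0, abs_of_nonneg hs0.le]
    have := mul_le_of_le_one_left (show 0 ≤ Δ + s by positivity) (hA a ha 0)
    refine le_max_of_le_right ?_
    linarith
  obtain ⟨ν, hν, h1, h2, b, hb, h3, h4⟩ := exists_hard_environment g hp alg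
    (fun (e : ℤˣ) _ => Δ * ((e : ℤ) : ℝ)) (fun _ => s) T hv
    (fun seed => one_dim_regret g alg hA seed hΔ0 hs0.ne' T hinfo) hbd hvar
  refine ⟨ν, hν, h1, h2, b, hb, h3, le_trans ?_ h4⟩
  have e : (T : ℝ) * (Δ / 2) = c / 20 * q * s := by
    rw [hΔ, ← hq2]; field_simp; norm_num
  rw [e]
  have : 0 ≤ c * q := by positivity
  nlinarith [mul_nonneg this hσ.le, mul_le_mul_of_nonneg_left hs1 this]

/-- The lower bound in dimension at least two. -/
lemma exists_hard_of_two_le_dim {p : ENNReal} (hp : 2 ≤ p) {n T : ℕ} (hn : 1 ≤ n) {r : ℝ}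
    (hr : r = (p⁻¹).toReal) (hr2 : r < 1 / 2) (hT : (n : ℝ) + 1 ≤ Real.sqrt T)
    (hT2 : ∀ u : ℝ, 0 < u → u ≤ 1 / Real.sqrt T →
      ((n : ℝ) + 1) ^ (1 - r) * u ^ (1 / 2 - r) ≤ 1) {σ : ℝ} (hσ : 0 < σ)
    (alg : BanditAlgorithm (n + 1) (lpBall (n + 1) p)) :
    ∃ (ν : Measure (Fin (n + 1) → ℝ)) (_ : IsProbabilityMeasure ν),
      (∀ a ∈ lpBall (n + 1) p, ∀ᵐ θ ∂ν, |a ⬝ᵥ θ| ≤ max 1 σ) ∧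
      IsGreatest (actionVariance ν '' lpBall (n + 1) p) (σ ^ 2 / 2) ∧
      ∃ aStar ∈ lpBall (n + 1) p,
        IsMaxOn (fun a => a ⬝ᵥ meanVector ν) (lpBall (n + 1) p) aStar ∧
        gapConst g / 1600 * (((n : ℝ) + 1) * (Real.sqrt T * σ))
          ≤ ∫ ω, alg.regret ν aStar T ω ∂(alg.law ν) := by
  have hp1 : 1 ≤ p := one_le_two.trans hp
  have hL := g.hellingerConst_nonneg
  have hc0 := gapConst_pos g
  have hc := gapConst_mul g
  set c := gapConst g
  set L := g.hellingerConst
  have hcL : 0 ≤ c * L := by positivity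
  have hc1 : c ≤ 1 / 2 := by nlinarith
  have hn1 : (1 : ℝ) ≤ n := by exact_mod_cast hn
  have hd0 : (0 : ℝ) < (n : ℝ) + 1 := by positivity
  have hq2 : Real.sqrt T ^ 2 = T := Real.sq_sqrt T.cast_nonneg
  set q := Real.sqrt T
  have hq0 : 0 < q := by linarith
  have hA : ∀ a ∈ lpBall (n + 1) p, ∀ j, |a j| ≤ 1 := fun a ha => abs_le_one_of_mem_lpBall hp1 ha
  -- Here `u` is the budget per coordinate: the comparison action has minor entries `±u^r`, whose
  -- `p`-th powers are `u` for finite `p`.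
  set u := c / q with hu
  have hu0 : 0 < u := by positivity
  have huq : u * q = c := div_mul_cancel₀ _ hq0.ne'
  have hdu : ((n : ℝ) + 1) * u ≤ 1 / 2 := by nlinarith
  set M := σ / 100 with hM
  have hM0 : 0 < M := by positivity
  -- This choice makes a correct sign with entry `u^r` worth exactly `M u`.
  set Δ := M * u ^ (1 - r) with hΔ
  have hΔ0 : 0 < Δ := by positivity
  -- The scale `ρ` makes `Δ²/ρ²` proportional to `M² u`, so learning with a small first entry is too
  -- slow for its price; `hT2` keeps the total size `N * ρ` of this noise small.
  set ρ := 1 / 40 * u ^ (1 / 2 - r) with hρ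
  have hρ0 : 0 < ρ := by positivity
  set x2 := u ^ (2 * r) with hx2
  have hx0 : 0 < x2 := by positivity
  set N := ((n : ℝ) + 1) ^ (1 - r) with hN
  have hN0 : 0 < N := by positivity
  have hρN : N * ρ ≤ 1 / 40 := by
    have := hT2 u hu0 (by rw [hu]; gcongr; linarith)
    rw [hρ]; linarith
  have hΔN : N * Δ ≤ M := by
    have h1 : N * u ^ (1 - r) ≤ 1 := by
      rw [hN, ← Real.mul_rpow hd0.le hu0.le]
      exact Real.rpow_le_one (by positivity) (by linarith) (by linarith)
    rw [hΔ]; nlinarith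
  have hnN : (n : ℝ) + 1 ≤ N ^ 2 := by
    rw [hN, ← Real.rpow_natCast, ← Real.rpow_mul hd0.le]
    have := Real.rpow_le_rpow_of_exponent_le (x := (n : ℝ) + 1) (by linarith)
      (show 1 ≤ (1 - r) * ((2 : ℕ) : ℝ) by push_cast; linarith)
    rwa [Real.rpow_one] at this
  have hΔx : Δ ^ 2 * x2 = M ^ 2 * u ^ 2 := by
    have : (u ^ (1 - r)) ^ 2 * u ^ (2 * r) = u ^ 2 := by
      rw [← Real.rpow_natCast, ← Real.rpow_mul hu0.le, ← Real.rpow_add hu0, ← Real.rpow_natCast]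
      congr 1; push_cast; ring
    rw [hΔ, hx2, mul_pow, mul_assoc, this]
  have hΔρ : Δ ^ 2 = 1600 * M ^ 2 * u * ρ ^ 2 := by
    have : (u ^ (1 - r)) ^ 2 = u * (u ^ (1 / 2 - r)) ^ 2 := by
      rw [← Real.rpow_natCast, ← Real.rpow_mul hu0.le, ← Real.rpow_natCast, ← Real.rpow_mul hu0.le]
      nth_rewrite 2 [← Real.rpow_one u]
      rw [← Real.rpow_add hu0]
      congr 1; push_cast; ring
    rw [hΔ, hρ, mul_pow, mul_pow, this]; ring
  have hΔr : u ^ r * Δ = M * u := by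
    have : u ^ r * u ^ (1 - r) = u := by
      rw [← Real.rpow_add hu0]; simp
    rw [hΔ]; linear_combination M * this
  set w : Fin (n + 1) → ℝ := Fin.cons 1 fun _ => ρ with hw
  obtain ⟨s, hs1, hs2, hvar⟩ := exists_noise_scale g hp1 w 0 rfl
    (fun a ha => by
      have hsq := fun j => (sq_le_one_iff_abs_le_one _).2 (hA a ha j)
      rw [Fin.sum_univ_succ]
      simp only [hw, Fin.cons_zero, Fin.cons_succ]
      rw [← Finset.mul_sum]
      have h1 := Finset.sum_le_sum fun (i : Fin n) (_ : i ∈ Finset.univ) => hsq i.succ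
      simp only [Finset.sum_const, Finset.card_univ, Fintype.card_fin, nsmul_eq_mul, mul_one] at h1
      have h2 : ρ ^ 2 * ∑ i : Fin n, a i.succ ^ 2 ≤ ρ ^ 2 * N ^ 2 := by
        gcongr; linarith
      have h3 : 0 ≤ N * ρ := by positivity
      nlinarith [hsq 0]) hσ
  have hs0 : 0 < s := by linarith
  have hD : ∀ j, s * w j ≠ 0 := by
    intro j
    refine mul_ne_zero hs0.ne' ?_
    refine Fin.cases ?_ (fun i => ?_) j
    · simp [hw]
    · simpa [hw] using hρ0.ne'
  have ha1 : ∀ a ∈ lpBall (n + 1) p, a 0 ≤ 1 := fun a ha => (abs_le.1 (hA a ha 0)).2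
  have hy : ∀ a ∈ lpBall (n + 1) p,
      ∑ i : Fin n, a i.succ ^ 2 ≤ x2 * n + 2 * x2 / u * (1 - a 0) := fun a ha => by
    have := sum_sq_le_of_mem_lpBall hp ha hu0
    rw [← hr] at this
    refine this.trans (le_of_eq ?_)
    rw [hx2]; ring
  -- This balances the gain `l * a_i²` against the information term, which is of order `T/l` times
  -- `(Δ/σ)² a_i²`.
  set l := Δ * q / σ with hl
  have hl0 : 0 < l := by positivity
  have hlq : l * σ = Δ * q := div_mul_cancel₀ _ hσ.ne'
  have hLl : Δ * (L * T / (2 * l)) = L * q * σ / 2 := by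
    rw [hl, ← hq2]; field_simp
  have e1 : Δ * (l * (x2 * n) + L * T / (2 * l) * (64 * Δ ^ 2 / σ ^ 2 * (x2 * n)))
      = M / 100 * c * (1 + 32 * L) * (u * n) := by
    calc _ = (Δ ^ 2 * x2) * q / σ * n + Δ * (L * T / (2 * l)) * (64 * (Δ ^ 2 * x2) / σ ^ 2 * n) := by
          rw [hl]; ring
      _ = _ := by
          rw [hLl, hΔx, ← huq, hM]; field_simp; ring
  have e2 : Δ * (l * (2 * x2 / u) + L * T / (2 * l) * (64 * Δ ^ 2 / σ ^ 2 * (2 * x2 / u)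
        + 32 * Δ ^ 2 / (ρ ^ 2 * σ ^ 2))) = M / 100 * c * (2 + 25664 * L) := by
    calc _ = (Δ ^ 2 * x2) * q / σ * 2 / u + Δ * (L * T / (2 * l)) *
            (128 * (Δ ^ 2 * x2) / σ ^ 2 / u + 32 * Δ ^ 2 / (ρ ^ 2 * σ ^ 2)) := by
          rw [hl]; ring
      _ = _ := by
          rw [hLl, hΔx, hΔρ, ← huq, hM]; field_simp; ring
  -- The comparison action loses `3nMu/4` in the first entry and gains `nMu` in the others, a
  -- surplus of `nMu/4 = 2γ`.
  set γ := n * M * u / 8 with hγ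
  have hun : 0 ≤ u * n := by positivity
  have hv : ∀ ε : Fin n → ℤˣ, ∃ b ∈ lpBall (n + 1) p, M + 2 * γ ≤ b ⬝ᵥ signMean M Δ ε := fun ε => by
    refine ⟨_, cons_mem_lpBall hp hu0 (by linarith) (e := fun i => ((ε i : ℤ) : ℝ))
      fun i => abs_units_cast (ε i), ?_⟩
    rw [dotProduct, Fin.sum_univ_succ]
    simp only [signMean, Fin.cons_zero, Fin.cons_succ, ← hr]
    have e : ∀ i : Fin n, u ^ r * ((ε i : ℤ) : ℝ) * (Δ * ((ε i : ℤ) : ℝ)) = M * u := fun i => by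
      have := sq_units_cast (ε i)
      linear_combination hΔr * ((ε i : ℤ) : ℝ) ^ 2 + M * u * this
    simp only [e, Finset.sum_const, Finset.card_univ, Fintype.card_fin, nsmul_eq_mul]
    rw [hγ]
    linarith
  have hg : ∀ a ∈ lpBall (n + 1) p,
      ∑ i : Fin n, snr (Pi.single i.succ (2 * Δ)) (fun j => s * w j) a
        ≤ 64 * Δ ^ 2 / σ ^ 2 * (x2 * n)
          + (64 * Δ ^ 2 / σ ^ 2 * (2 * x2 / u) + 32 * Δ ^ 2 / (ρ ^ 2 * σ ^ 2)) * (1 - a 0) := by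
    intro a ha
    refine (sum_snr_le (Δ := Δ) hσ hs1 hρ0 (ha1 a ha)).trans ?_
    have := mul_le_mul_of_nonneg_left (hy a ha) (show 0 ≤ 64 * Δ ^ 2 / σ ^ 2 by positivity)
    linarith
  have hgain : M / 100 * c * (1 + 32 * L) * (u * n) ≤ γ := by
    rw [hγ]
    have : c * (1 + 32 * L) ≤ 1 / 2 := by linarith
    have h5 : 0 ≤ M * (u * n) := by positivity
    have h6 := mul_le_mul_of_nonneg_left this h5
    linarith
  -- By `gapConst_mul`, `c (2 + 25664 L) ≤ 26 c (1 + 1000 L) = 13`.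
  have hcost : M / 100 * c * (2 + 25664 * L) ≤ M := by
    have : c * (2 + 25664 * L) ≤ 100 := by linarith
    have h6 := mul_le_mul_of_nonneg_left this hM0.le
    linarith
  have hbd : ∀ ε : Fin n → ℤˣ, ∀ a ∈ lpBall (n + 1) p,
      ∑ j, |a j| * (|signMean M Δ ε j| + |s * w j|) ≤ max 1 σ := by
    intro ε a ha
    rw [Fin.sum_univ_succ]
    simp only [signMean, hw, Fin.cons_zero, Fin.cons_succ, abs_mul, abs_units_cast, mul_one,
      abs_of_pos hΔ0, abs_of_pos hs0, abs_of_pos hρ0, abs_of_pos hM0]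
    rw [← Finset.sum_mul]
    have hsum := sum_abs_le_of_mem_lpBall (by omega) hp1 ha
    rw [Fin.sum_univ_succ, ← hr] at hsum
    push_cast at hsum
    rw [← hN] at hsum
    have h5 : ∑ i : Fin n, |a i.succ| ≤ 2 * N := by linarith [abs_nonneg (a 0)]
    have h6 : (∑ i : Fin n, |a i.succ|) * (Δ + s * ρ) ≤ 2 * N * (Δ + s * ρ) := by gcongr
    have h7 : |a 0| * (M + s) ≤ M + s :=
      mul_le_of_le_one_left (by positivity) (hA a ha 0)
    have h8 : s * (N * ρ) ≤ s * (1 / 40) := by gcongr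
    -- The total is at most `M + s + 2N(Δ + sρ) ≤ (0.01 + 0.9 + 0.02 + 0.045) σ`, so rewards are in
    -- fact bounded by `σ`.
    refine le_max_of_le_right ?_
    linarith
  obtain ⟨ν, hν, h1, h2, b, hb, h3, h4⟩ := exists_hard_environment g hp1 alg
    (signMean M Δ) (fun j => s * w j) T hv
    (fun seed => card_mul_le_sum_regret g alg hA seed hΔ0.le _ hD T hl0 hy hg (e1.trans_le hgain)
      (e2.trans_le hcost)) hbd hvar
  refine ⟨ν, hν, h1, h2, b, hb, h3, le_trans ?_ h4⟩
  have e : (T : ℝ) * γ = c / 800 * (n * (q * σ)) := by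
    rw [hγ, hM, ← hq2, ← huq]; ring
  rw [e]
  have : 0 ≤ c * (q * σ) := by positivity
  linarith [mul_le_mul_of_nonneg_left hn1 this]

end BanditAlgorithm

theorem mainTheorem7 :
    ∃ c : ℝ, 0 < c ∧ ∃ k : ℕ,
      ∀ (d : ℕ) (p q : ENNReal) (T : ℕ) (σ : ℝ),
        1 ≤ d → 2 < p → p.HolderConjugate q →
        (d : ℝ) ^ (4 / (2 - q.toReal)) ≤ (T : ℝ) → 0 < σ →
        ∀ alg : BanditAlgorithm d (lpBall d p),
          ∃ (ν : Measure (Fin d → ℝ)) (_ : IsProbabilityMeasure ν),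
            (∀ a ∈ lpBall d p, ∀ᵐ θ ∂ν, |a ⬝ᵥ θ| ≤ max 1 σ) ∧
            IsGreatest (actionVariance ν '' lpBall d p) (σ ^ 2 / 2) ∧
            ∃ aStar ∈ lpBall d p,
              IsMaxOn (fun a => a ⬝ᵥ meanVector ν) (lpBall d p) aStar ∧
              c * (d * Real.sqrt (T * σ ^ 2)) / (1 + Real.log T) ^ k ≤
                ∫ ω, alg.regret ν aStar T ω ∂(alg.law ν) := by
  obtain ⟨g⟩ := NoiseAmplitude.exists_noiseAmplitude
  -- The witness `k = 0` means that no logarithmic factor is lost.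
  refine ⟨BanditAlgorithm.gapConst g / 1600, div_pos (BanditAlgorithm.gapConst_pos g) (by norm_num),
    0, fun d p q T σ hd hp hpq hT hσ alg => ?_⟩
  obtain ⟨hr, hq⟩ := toReal_inv_lt_half hp hpq
  rw [hq] at hT
  have hd1 : (1 : ℝ) ≤ d := by exact_mod_cast hd
  obtain ⟨h1, h2⟩ := horizon_bounds hr hd1 hT
  have hsqrt : Real.sqrt (T * σ ^ 2) = Real.sqrt T * σ := by
    rw [Real.sqrt_mul T.cast_nonneg, Real.sqrt_sq hσ.le]
  rw [hsqrt]
  simp only [pow_zero, div_one]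
  obtain ⟨n, rfl⟩ : ∃ n, d = n + 1 := ⟨d - 1, by omega⟩
  rcases Nat.eq_zero_or_pos n with rfl | hn
  · have hT1 : 1 ≤ T := by
      have : (1 : ℝ) ≤ T := Real.one_le_sqrt.1 (hd1.trans h1)
      exact_mod_cast this
    simpa using BanditAlgorithm.exists_hard_one_dim g (one_le_two.trans hp.le) hT1 hσ alg
  · push_cast at h1 h2 ⊢
    exact BanditAlgorithm.exists_hard_of_two_le_dim g hp.le hn rfl hr h1 h2 hσ alg
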